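/- Let $d,k\ge 0$ be integers, let $\Gamma$ be an (additively written) group isomorphic to $\mathbb{Z}^k$, and let $L:\Gamma\to\mathbb{R}^d$ be a nonsingular homomorphism, i.e. $L(\Gamma)$ spans a $k$-dimensional linear subspace of $\mathbb{R}^d$ (so $k\le d$). Let $(G,\psi)$ be a finite $\Gamma$-labeled graph: a finite directed multigraph $G=(V,E)$ without loops and a map $\psi:E\to\Gamma$, such that no two distinct edges are parallel with the same direction and the same label, or with opposite directions and opposite labels. For $p:V\to\mathbb{R}^d$ put $$f_{G,L}(p)=\bigl(\|p(u)-(p(v)+L(\psi(e)))\|^2\bigr)_{e\in E,\ e\text{ directed from }u\text{ to }v},\qquad f_{V,L}(p)=\bigl(\|p(u)-(p(v)+L(\gamma))\|^2\bigr)_{(u,v,\gamma)\in V\times V\times\Gamma}.$$ The triple $(G,\psi,p)$ is called $L$-periodically globally rigid if for every $q:V\to\mathbb{R}^d$, $f_{G,L}(p)=f_{G,L}(q)$ implies $f_{V,L}(p)=f_{V,L}(q)$; it is called $L$-periodically rigid if this implication holds for every $q$ in some open neighbourhood of $p$ in $(\mathbb{R}^d)^V$; and it is called redundantly $L$-periodically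 rigid if $(G-e,\psi|_{E\setminus\{e\}},p)$ is $L$-periodically rigid for every $e\in E$. It is called generic if the $d|V|$ coordinates of the points $p(v)$, $v\in V$, are algebraically independent over the field generated over $\mathbb{Q}$ by the coordinates of the vectors $L(\gamma)$, $\gamma\in\Gamma$ (this field is $\mathbb{Q}$ if $L$ is rational-valued). Suppose that $(G,\psi,p)$ is generic, and that $|V|\ge d+1$ if $k\ge 1$ and $|V|\ge d+2$ if $k=0$. If $(G,\psi,p)$ is $L$-periodically globally rigid, then it is redundantly $L$-periodically rigid. -/

import Mathlib

/-- A directed multigraph on the vertex set `V` with edge set `E`, together with a labelling of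
its edges by elements of `Γ` (written additively). -/
structure LabeledGraph (V E Γ : Type*) where
  /-- initial vertex of an edge -/
  src : E → V
  /-- terminal vertex of an edge -/
  tgt : E → V
  /-- label of an edge, with respect to its direction -/
  label : E → Γ

namespace LabeledGraph

/-- No edge joins a vertex to itself. -/
def IsLoopless {V E Γ : Type*} (G : LabeledGraph V E Γ) : Prop :=
  ∀ e : E, G.src e ≠ G.tgt e

/-- Two edges are identical if they are parallel with the same direction and the same label, or
with opposite directions and opposite labels. -/
def Identical {V E Γ : Type*} [AddCommGroup Γ] (G : LabeledGraph V E Γ) (e e' : E) : Prop :=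
  (G.src e = G.src e' ∧ G.tgt e = G.tgt e' ∧ G.label e = G.label e') ∨
  (G.src e = G.tgt e' ∧ G.tgt e = G.src e' ∧ G.label e = -G.label e')

/-- No two distinct edges are identical. -/
def IsSemiSimple {V E Γ : Type*} [AddCommGroup Γ] (G : LabeledGraph V E Γ) : Prop :=
  ∀ e e' : E, G.Identical e e' → e = e'

/-- The graph `G - e`. -/
def deleteEdge {V E Γ : Type*} (G : LabeledGraph V E Γ) (e : E) :
    LabeledGraph V {e' : E // e' ≠ e} Γ where
  src e' := G.src e'.1
  tgt e' := G.tgt e'.1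
  label e' := G.label e'.1

/-- The complete `Γ`-labeled graph `K(V, Γ)`: one edge from `u` to `v` with label `γ`, for all
`u`, `v` and `γ`. -/
def complete (V Γ : Type*) : LabeledGraph V (V × V × Γ) Γ where
  src e := e.1
  tgt e := e.2.1
  label e := e.2.2

/-- The squared length function `f_{G,L}`. -/
noncomputable def lengthSq {V E Γ : Type*} [AddCommGroup Γ] {d : ℕ} (G : LabeledGraph V E Γ)
    (L : Γ →+ EuclideanSpace ℝ (Fin d)) (p : V → EuclideanSpace ℝ (Fin d)) : E → ℝ :=
  fun e => ‖p (G.src e) - (p (G.tgt e) + L (G.label e))‖ ^ 2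

/-- `L`-periodic global rigidity of the `Γ`-labeled framework `(G, p)`: for every `q`,
`f_{G,L}(p) = f_{G,L}(q)` implies `f_{V,L}(p) = f_{V,L}(q)`. -/
def IsPeriodicallyGloballyRigid {V E Γ : Type*} [AddCommGroup Γ] {d : ℕ}
    (G : LabeledGraph V E Γ) (L : Γ →+ EuclideanSpace ℝ (Fin d))
    (p : V → EuclideanSpace ℝ (Fin d)) : Prop :=
  ∀ q : V → EuclideanSpace ℝ (Fin d), G.lengthSq L p = G.lengthSq L q →
    (complete V Γ).lengthSq L p = (complete V Γ).lengthSq L q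

/-- `L`-periodic (local) rigidity of the `Γ`-labeled framework `(G, p)`: the implication
that defines global rigidity holds for every `q` in some open neighbourhood of `p`. -/
def IsPeriodicallyRigid {V E Γ : Type*} [AddCommGroup Γ] {d : ℕ}
    (G : LabeledGraph V E Γ) (L : Γ →+ EuclideanSpace ℝ (Fin d))
    (p : V → EuclideanSpace ℝ (Fin d)) : Prop :=
  ∃ N : Set (V → EuclideanSpace ℝ (Fin d)), IsOpen N ∧ p ∈ N ∧
    ∀ q ∈ N, G.lengthSq L p = G.lengthSq L q →
      (complete V Γ).lengthSq L p = (complete V Γ).lengthSq L q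

/-- Redundant `L`-periodic rigidity: `(G - e, p)` is `L`-periodically rigid for every edge `e`. -/
def IsRedundantlyPeriodicallyRigid {V E Γ : Type*} [AddCommGroup Γ] {d : ℕ}
    (G : LabeledGraph V E Γ) (L : Γ →+ EuclideanSpace ℝ (Fin d))
    (p : V → EuclideanSpace ℝ (Fin d)) : Prop :=
  ∀ e : E, (G.deleteEdge e).IsPeriodicallyRigid L p

end LabeledGraph

/-- For `Γ ≅ ℤ^k`, the homomorphism `L` is nonsingular if `L(Γ)` has rank `k`, i.e. spans a
`k`-dimensional linear subspace. -/
def IsNonsingularLattice {Γ : Type*} [AddCommGroup Γ] {d : ℕ} (k : ℕ)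
    (L : Γ →+ EuclideanSpace ℝ (Fin d)) : Prop :=
  Module.finrank ℝ (Submodule.span ℝ (Set.range L)) = k

/-- The subfield `ℚ(H)` of `ℝ` generated by the coordinates of the vectors `L(γ)`. It is `ℚ` if
`L` is rational-valued. -/
noncomputable def coordField {Γ : Type*} [AddCommGroup Γ] {d : ℕ}
    (L : Γ →+ EuclideanSpace ℝ (Fin d)) : IntermediateField ℚ ℝ :=
  IntermediateField.adjoin ℚ {x : ℝ | ∃ (γ : Γ) (i : Fin d), L γ i = x}

/-- `p` is generic with respect to `L` if its coordinates are algebraically independent over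
`ℚ(H)`, hence over `ℚ` if `L` is rational-valued. -/
def IsGenericRealization {V Γ : Type*} [AddCommGroup Γ] {d : ℕ}
    (L : Γ →+ EuclideanSpace ℝ (Fin d)) (p : V → EuclideanSpace ℝ (Fin d)) : Prop :=
  AlgebraicIndependent (coordField L) (fun vi : V × Fin d => p vi.1 vi.2)

/-! This is Hendrickson's argument, adapted to periodic frameworks. Let `U` be the span of `L(Γ)`.
The lengths `f_{V,L}` carry the same information as the invariants `congruenceMap U` of a
configuration under the isometries whose linear part fixes `U`. Suppose that `G' = G - e` is not
rigid at `p`. Global rigidity of `G` makes it infinitesimally rigid at the generic `p`, so removing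
one edge leaves exactly one nontrivial infinitesimal motion: the kernel of the derivative of
`f_{G',L}` has dimension `D + 1`, where `D` is the dimension of the infinitesimal congruences.

The whole fibre of `f_{G',L}` through `p` must be as regular as `p` itself. A derivation of `ℝ` over
the field of lattice coordinates can take arbitrary values on the coordinates of `p`. Applied to
`f(q) = f(p)`, it shows that the range of the derivative at `p` lies in that at `q`
(`range_rigidityMap_le_of_generic`). As the rank is maximal at `p`, the kernel at `q` also has
dimension `D + 1`. A degenerate `q` would have at least `D + 2` infinitesimal congruences
(`add_two_le_finrank_infinitesimalCongruences`, which needs the bound on `|V|`), so every `q` in the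
fibre is nondegenerate. By the constant rank theorem the fibre modulo congruences is then a curve.

Let `Y` be the part of this curve where `e` is no longer than at `p`. It is compact since `G` is
connected. By global rigidity only the class of `p` attains the original length of `e`, and there
this length is a local coordinate. Hence `Y` would be a compact curve with exactly one boundary
point, which is impossible (`not_isHalfArcAt_of_isArcAt`): a segment starting at the boundary point
can always be prolonged, contradicting Zorn's lemma. -/

/-! ### Derivations and matrix ranks at algebraically independent points -/

/-- The field is formally étale over the polynomial ring on the transcendence basis, so its
differentials are the base change of the free module of polynomial differentials, where values on
the variables may be prescribed. -/
theorem exists_derivation_of_isTranscendenceBasis {K L ι : Type*} [Field K] [Field L] [CharZero L]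
    [Algebra K L] {v : ι → L} (hv : IsTranscendenceBasis K v) (w : ι → L) :
    ∃ D : Derivation K L L, ∀ i, D (v i) = w i := by
  let S := MvPolynomial ι K
  let : Algebra S L := (MvPolynomial.aeval v : S →ₐ[K] L).toAlgebra
  have : IsScalarTower K S L :=
    IsScalarTower.of_algebraMap_eq fun x => ((MvPolynomial.aeval v : S →ₐ[K] L).commutes x).symm
  have : FaithfulSMul S L := (faithfulSMul_iff_algebraMap_injective S L).2 hv.1
  have : Algebra.IsAlgebraic S L := by
    have h := hv.isAlgebraic
    refine ⟨fun x => ?_⟩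
    obtain ⟨P, hP, hx⟩ := h.isAlgebraic x
    -- Algebraicity is given over the subalgebra generated by `v`; the equation is transported along
    -- its isomorphism with the polynomial ring.
    refine ⟨P.map (hv.1.aevalEquiv.symm : _ →+* S), ?_, ?_⟩
    · rwa [Ne, Polynomial.map_eq_zero_iff hv.1.aevalEquiv.symm.injective]
    · rw [← hx, Polynomial.aeval_def, Polynomial.aeval_def, Polynomial.eval₂_map]
      congr 1
      ext y
      obtain ⟨z, rfl⟩ := hv.1.aevalEquiv.surjective y
      simp only [RingHom.coe_comp, Function.comp_apply]
      erw [hv.1.aevalEquiv.symm_apply_apply]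
      exact (hv.1.algebraMap_aevalEquiv z).symm
  let F := FractionRing S
  let : Algebra F L := FractionRing.liftAlgebra S L
  have : Algebra.IsAlgebraic F L := (IsFractionRing.comap_isAlgebraic_iff (A := S)).1 ‹_›
  have : CharZero F := (algebraMap F L).charZero
  -- A localization, followed by an algebraic extension that is separable in characteristic zero.
  have : Algebra.FormallyEtale S F := .of_isLocalization (nonZeroDivisors S)
  have : Algebra.FormallyEtale F L := Algebra.FormallyEtale.of_isSeparable F L
  have : Algebra.FormallyEtale S L := .comp S F L
  let D₀ : Derivation K S L := MvPolynomial.mkDerivation K w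
  let Φ : Ω[L⁄K] →ₗ[L] L := (LinearMap.liftBaseChange L D₀.liftKaehlerDifferential) ∘ₗ
    (KaehlerDifferential.tensorKaehlerEquivOfFormallyEtale K S L).symm.toLinearMap
  refine ⟨Φ.compDer (KaehlerDifferential.D K L), fun i => ?_⟩
  have h1 : v i = algebraMap S L (MvPolynomial.X i) := (MvPolynomial.aeval_X v i).symm
  change Φ (KaehlerDifferential.D K L (v i)) = w i
  simp only [Φ, LinearMap.comp_apply, LinearEquiv.coe_coe]
  rw [h1, KaehlerDifferential.tensorKaehlerEquivOfFormallyEtale_symm_D_algebraMap]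
  have h2 : D₀ (MvPolynomial.X i) = w i := MvPolynomial.mkDerivation_X K w i
  simp [h2]

/-- Over a subfield in characteristic zero, there are derivations with arbitrary prescribed values
on an algebraically independent family. -/
theorem AlgebraicIndependent.exists_derivation {K L ι : Type*} [Field K] [Field L] [CharZero L]
    [Algebra K L] {v : ι → L} (hv : AlgebraicIndependent K v) (w : ι → L) :
    ∃ D : Derivation K L L, ∀ i, D (v i) = w i := by
  obtain ⟨t, hvt, ht⟩ := exists_isTranscendenceBasis_superset hv.coe_range
  obtain ⟨D, hD⟩ := exists_derivation_of_isTranscendenceBasis ht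
    (fun x : t => Function.extend v w 0 x.1)
  refine ⟨D, fun i => ?_⟩
  rw [hD ⟨v i, hvt ⟨i, rfl⟩⟩, hv.injective.extend_apply]

/-- The rank of a polynomial matrix is maximal at an algebraically independent point. -/
theorem AlgebraicIndependent.rank_map_aeval_le {K ι m n : Type*} [Field K] [Algebra K ℝ]
    [Fintype m] [Fintype n] {v : ι → ℝ} (hv : AlgebraicIndependent K v)
    (A : Matrix m n (MvPolynomial ι K)) (x : ι → ℝ) :
    (A.map (MvPolynomial.aeval x)).rank ≤ (A.map (MvPolynomial.aeval v)).rank := by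
  classical
  obtain ⟨f, hf, -, hli⟩ := Submodule.exists_fun_fin_finrank_span_eq ℝ
    (Set.range (A.map (MvPolynomial.aeval x)).row)
  choose r hr using hf
  rw [Matrix.rank_eq_finrank_span_row]
  generalize Module.finrank ℝ (Submodule.span ℝ (Set.range (A.map (MvPolynomial.aeval x)).row)) = ρ
    at f hli r hr
  -- These rows form a basis of the row space at `x`. Over `ℝ` their independence is detected by the
  -- single polynomial `det (C * Cᵀ)`; being nonzero at `x`, it is a nonzero polynomial and hence
  -- does not vanish at `v`.
  let C : Matrix (Fin ρ) n (MvPolynomial ι K) := A.submatrix r id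
  have hmap : ∀ y : ι → ℝ, (C * C.transpose).map (MvPolynomial.aeval y) =
      (C.map (MvPolynomial.aeval y)) * (C.map (MvPolynomial.aeval y)).transpose := by
    intro y
    rw [Matrix.map_mul, Matrix.transpose_map]
  have hdet : ∀ y : ι → ℝ, MvPolynomial.aeval y (C * C.transpose).det =
      ((C.map (MvPolynomial.aeval y)) * (C.map (MvPolynomial.aeval y)).transpose).det := by
    intro y
    rw [← hmap, AlgHom.map_det]
    rfl
  have hx : (C.map (MvPolynomial.aeval x)).rank = ρ := by
    have : LinearIndependent ℝ (C.map (MvPolynomial.aeval x)).row := by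
      convert! hli using 1
      ext i : 1
      exact hr i
    simpa using this.rank_matrix
  have hne : (C * C.transpose).det ≠ 0 := by
    intro h0
    have h1 := hdet x
    rw [h0, map_zero] at h1
    obtain ⟨z, hz, hz'⟩ := Matrix.exists_mulVec_eq_zero_iff.2 h1.symm
    have h2 := Matrix.rank_self_mul_transpose (C.map (MvPolynomial.aeval x))
    rw [hx] at h2
    have h3 := LinearMap.finrank_range_add_finrank_ker
      ((C.map (MvPolynomial.aeval x)) * (C.map (MvPolynomial.aeval x)).transpose).mulVecLin
    have h4 : 0 < Module.finrank ℝ (LinearMap.ker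
      ((C.map (MvPolynomial.aeval x)) * (C.map (MvPolynomial.aeval x)).transpose).mulVecLin) :=
      Module.finrank_pos_iff_exists_ne_zero.2 ⟨⟨z, hz'⟩, fun h => hz (congrArg Subtype.val h)⟩
    rw [Matrix.rank] at h2
    simp at h3
    omega
  have hv' : MvPolynomial.aeval v (C * C.transpose).det ≠ 0 := by
    rwa [Ne, (injective_iff_map_eq_zero' _).1 hv]
  rw [hdet] at hv'
  have h5 := Matrix.rank_of_isUnit _ ((Matrix.isUnit_iff_isUnit_det _).2 hv'.isUnit)
  rw [Matrix.rank_self_mul_transpose] at h5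
  calc ρ = (C.map (MvPolynomial.aeval v)).rank := by rw [h5]; simp
    _ ≤ _ := Matrix.rank_submatrix_le (A.map (MvPolynomial.aeval v)) r id

/-! ### The rigidity map and its behaviour at generic realizations -/

open scoped RealInnerProductSpace

namespace LabeledGraph

variable {V E Γ : Type*} [AddCommGroup Γ] {d : ℕ}

/-- The derivative of the squared length function `f_{G,L}` at `p`. -/
noncomputable def rigidityMap (G : LabeledGraph V E Γ) (L : Γ →+ EuclideanSpace ℝ (Fin d))
    (p : V → EuclideanSpace ℝ (Fin d)) : (V → EuclideanSpace ℝ (Fin d)) →L[ℝ] (E → ℝ) :=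
  ContinuousLinearMap.pi fun e =>
    (2 : ℕ) • (innerSL ℝ (p (G.src e) - (p (G.tgt e) + L (G.label e)))).comp
      (ContinuousLinearMap.proj (R := ℝ) (φ := fun _ : V => EuclideanSpace ℝ (Fin d)) (G.src e) -
        ContinuousLinearMap.proj (R := ℝ) (φ := fun _ : V => EuclideanSpace ℝ (Fin d)) (G.tgt e))

theorem rigidityMap_apply (G : LabeledGraph V E Γ) (L : Γ →+ EuclideanSpace ℝ (Fin d))
    (p w : V → EuclideanSpace ℝ (Fin d)) (e : E) :
    G.rigidityMap L p w e =
      2 * ⟪p (G.src e) - (p (G.tgt e) + L (G.label e)), w (G.src e) - w (G.tgt e)⟫ := by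
  simp [rigidityMap, inner_sub_left, inner_sub_right, inner_add_left]

theorem contDiff_lengthSq [Fintype V] [Fintype E] (G : LabeledGraph V E Γ)
    (L : Γ →+ EuclideanSpace ℝ (Fin d)) :
    ContDiff ℝ 1 (G.lengthSq L) := by
  unfold lengthSq
  refine contDiff_pi.2 fun e => ContDiff.norm_sq ℝ ?_
  fun_prop

theorem hasFDerivAt_lengthSq [Fintype V] (G : LabeledGraph V E Γ) (L : Γ →+ EuclideanSpace ℝ (Fin d))
    (p : V → EuclideanSpace ℝ (Fin d)) : HasFDerivAt (G.lengthSq L) (G.rigidityMap L p) p := by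
  refine hasFDerivAt_pi.2 fun e => ?_
  have h : HasFDerivAt (fun q : V → EuclideanSpace ℝ (Fin d) =>
      q (G.src e) - (q (G.tgt e) + L (G.label e)))
      (ContinuousLinearMap.proj (R := ℝ) (φ := fun _ : V => EuclideanSpace ℝ (Fin d)) (G.src e) -
        ContinuousLinearMap.proj (R := ℝ) (φ := fun _ : V => EuclideanSpace ℝ (Fin d))
          (G.tgt e)) p := by
    have h1 := (ContinuousLinearMap.proj (R := ℝ) (φ := fun _ : V => EuclideanSpace ℝ (Fin d))
      (G.src e)).hasFDerivAt (x := p)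
    have h2 := (ContinuousLinearMap.proj (R := ℝ) (φ := fun _ : V => EuclideanSpace ℝ (Fin d))
      (G.tgt e)).hasFDerivAt (x := p)
    exact h1.sub (h2.add_const (L (G.label e)))
  exact h.norm_sq

/-- The matrix of the derivative of `f_{G,L}`, with polynomial entries. -/
noncomputable def rigidityMatrix (G : LabeledGraph V E Γ) (L : Γ →+ EuclideanSpace ℝ (Fin d)) :
    Matrix E (V × Fin d) (MvPolynomial (V × Fin d) (coordField L)) :=
  open Classical in Matrix.of fun e vi =>
    2 * (MvPolynomial.X (G.src e, vi.2) - (MvPolynomial.X (G.tgt e, vi.2) +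
      MvPolynomial.C ⟨L (G.label e) vi.2, IntermediateField.subset_adjoin _ _ ⟨_, _, rfl⟩⟩)) *
      ((if vi.1 = G.src e then 1 else 0) - (if vi.1 = G.tgt e then 1 else 0))

/-- Puts the rank into polynomial matrix form, so that `AlgebraicIndependent.rank_map_aeval_le`
applies. -/
theorem finrank_range_rigidityMap [Fintype V] [Fintype E] (G : LabeledGraph V E Γ)
    (L : Γ →+ EuclideanSpace ℝ (Fin d))
    (p : V → EuclideanSpace ℝ (Fin d)) :
    Module.finrank ℝ (G.rigidityMap L p).range =
      ((G.rigidityMatrix L).map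
        (MvPolynomial.aeval fun vi : V × Fin d => p vi.1 vi.2)).rank := by
  classical
  have key : ∀ w : V → EuclideanSpace ℝ (Fin d), G.rigidityMap L p w =
      ((G.rigidityMatrix L).map (MvPolynomial.aeval fun vi : V × Fin d => p vi.1 vi.2)).mulVec
        (fun vi => w vi.1 vi.2) := by
    intro w
    ext e
    rw [rigidityMap_apply, Matrix.mulVec, dotProduct, Fintype.sum_prod_type_right,
      PiLp.inner_apply, Finset.mul_sum]
    refine Finset.sum_congr rfl fun i _ => ?_
    have h : ∀ v, (G.rigidityMatrix L).map
        (MvPolynomial.aeval fun vi : V × Fin d => p vi.1 vi.2) e (v, i) * w v i =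
        (if v = G.src e then
          2 * (p (G.src e) i - (p (G.tgt e) i + L (G.label e) i)) * w v i else 0) -
        (if v = G.tgt e then
          2 * (p (G.src e) i - (p (G.tgt e) i + L (G.label e) i)) * w v i else 0) := by
      intro v
      have hC : algebraMap (coordField L) ℝ ⟨L (G.label e) i,
        IntermediateField.subset_adjoin _ _ ⟨_, _, rfl⟩⟩ = L (G.label e) i := rfl
      simp only [rigidityMatrix, Matrix.map_apply, Matrix.of_apply, map_mul, map_sub, map_add,
        MvPolynomial.aeval_X, MvPolynomial.aeval_C, hC, map_ofNat]
      split_ifs <;> simp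
    simp only [h, Finset.sum_sub_distrib, Finset.sum_ite_eq', Finset.mem_univ, if_true]
    simp
    ring
  have hrange : (G.rigidityMap L p).range = ((G.rigidityMatrix L).map
      (MvPolynomial.aeval fun vi : V × Fin d => p vi.1 vi.2)).mulVecLin.range := by
    ext y
    constructor
    · rintro ⟨w, rfl⟩
      exact ⟨_, (key w).symm⟩
    · rintro ⟨w, rfl⟩
      exact ⟨fun v => WithLp.toLp 2 fun i => w (v, i), key _⟩
  rw [Matrix.rank, hrange]

/-- The rank of the derivative of `f_{G,L}` is maximal at a generic realization. -/
theorem finrank_range_rigidityMap_le_of_generic [Fintype V] [Fintype E] (G : LabeledGraph V E Γ)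
    (L : Γ →+ EuclideanSpace ℝ (Fin d)) {p : V → EuclideanSpace ℝ (Fin d)}
    (hp : IsGenericRealization L p) (q : V → EuclideanSpace ℝ (Fin d)) :
    Module.finrank ℝ (G.rigidityMap L q).range ≤ Module.finrank ℝ (G.rigidityMap L p).range := by
  rw [finrank_range_rigidityMap, finrank_range_rigidityMap]
  exact hp.rank_map_aeval_le _ _

/-- The derivative of `f_{G,L}` at a generic `p` has smaller range than at any equivalent `q`. -/
theorem range_rigidityMap_le_of_generic (G : LabeledGraph V E Γ)
    (L : Γ →+ EuclideanSpace ℝ (Fin d)) {p q : V → EuclideanSpace ℝ (Fin d)}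
    (hp : IsGenericRealization L p) (hpq : G.lengthSq L q = G.lengthSq L p) :
    (G.rigidityMap L p).range ≤ (G.rigidityMap L q).range := by
  rintro _ ⟨w, rfl⟩
  obtain ⟨D, hD⟩ := AlgebraicIndependent.exists_derivation hp (fun vi => w vi.1 vi.2)
  -- `D` kills the lattice coordinates, so the Leibniz rule gives the chain rule for `f_{G,L}` with
  -- `D` in place of a time derivative.
  have key : ∀ x : V → EuclideanSpace ℝ (Fin d),
      G.rigidityMap L x (fun v => WithLp.toLp 2 fun i => D (x v i)) =
      fun e => D (G.lengthSq L x e) := by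
    intro x
    ext e
    have hL : ∀ i, D (L (G.label e) i) = 0 := fun i =>
      D.map_algebraMap (⟨L (G.label e) i, IntermediateField.subset_adjoin _ _ ⟨_, _, rfl⟩⟩ :
        coordField L)
    simp only [rigidityMap_apply, lengthSq, EuclideanSpace.real_norm_sq_eq, map_sum,
      PiLp.inner_apply, Finset.mul_sum]
    refine Finset.sum_congr rfl fun i _ => ?_
    simp [hL, Derivation.leibniz_pow]
    ring
  -- The velocity `D q` at `q` has the same image as `w = D p` at `p`, because both images are `D`
  -- of the same lengths.
  refine ⟨fun v => WithLp.toLp 2 fun i => D (q v i), ?_⟩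
  have hw : w = fun v => WithLp.toLp 2 fun i => D (p v i) := by
    ext v i
    exact (hD (v, i)).symm
  change G.rigidityMap L q _ = G.rigidityMap L p w
  rw [hw, key, key, hpq]

end LabeledGraph

/-! ### Dimension of the space of infinitesimal congruences -/

section Congruences

variable {V H : Type*} [NormedAddCommGroup H] [InnerProductSpace ℝ H]

/-- The skew-adjoint endomorphisms of a real inner product space. -/
def skewEnd (W : Type*) [NormedAddCommGroup W] [InnerProductSpace ℝ W] :
    Submodule ℝ (W →ₗ[ℝ] W) where
  carrier := {S | ∀ x y, ⟪S x, y⟫ + ⟪x, S y⟫ = 0}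
  add_mem' {S T} hS hT x y := by
    have h1 := hS x y
    have h2 := hT x y
    simp only [LinearMap.add_apply, inner_add_left, inner_add_right]
    linarith
  zero_mem' := by simp
  smul_mem' c S hS x y := by
    simp only [LinearMap.smul_apply, real_inner_smul_left, real_inner_smul_right, ← mul_add,
      hS x y, mul_zero]

theorem inner_skewEnd_apply_self {W : Type*} [NormedAddCommGroup W] [InnerProductSpace ℝ W]
    {S : W →ₗ[ℝ] W} (hS : S ∈ skewEnd W) (z : W) : ⟪S z, z⟫ = 0 := by
  have := hS z z
  rw [real_inner_comm (S z) z] at this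
  linarith

theorem finrank_ker_le_of_disjoint {M N N' : Type*} [AddCommGroup M] [Module ℝ M] [AddCommGroup N]
    [Module ℝ N] [AddCommGroup N'] [Module ℝ N'] [FiniteDimensional ℝ N'] {f : M →ₗ[ℝ] N}
    {g : M →ₗ[ℝ] N'} (h : Disjoint f.ker g.ker) :
    Module.finrank ℝ f.ker ≤ Module.finrank ℝ N' := by
  refine LinearMap.finrank_le_finrank_of_injective (f := g ∘ₗ f.ker.subtype) ?_
  rw [← LinearMap.ker_eq_bot, LinearMap.ker_comp, ← Submodule.disjoint_iff_comap_eq_bot]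
  exact h

/-- The velocities of the points `q v` that preserve all their distances and the components of
their differences in `U` to first order. -/
def infinitesimalCongruences (U : Submodule ℝ H) (q : V → H) : Submodule ℝ (V → H) where
  carrier := {w | ∀ u v, ⟪q u - q v, w u - w v⟫ = 0 ∧ w u - w v ∈ Uᗮ}
  add_mem' {w w'} hw hw' u v := by
    have : (w + w') u - (w + w') v = (w u - w v) + (w' u - w' v) := by
      simp only [Pi.add_apply]
      abel
    rw [this, inner_add_right, (hw u v).1, (hw' u v).1, add_zero]
    exact ⟨rfl, add_mem (hw u v).2 (hw' u v).2⟩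
  zero_mem' := by simp
  smul_mem' c w hw u v := by
    rw [Pi.smul_apply, Pi.smul_apply, ← smul_sub, real_inner_smul_right, (hw u v).1, mul_zero]
    exact ⟨rfl, Submodule.smul_mem _ _ (hw u v).2⟩

/-- No nonzero vector orthogonal to `U` is orthogonal to all differences of the points `q v`. -/
def SpansModulo (U : Submodule ℝ H) (q : V → H) : Prop :=
  ∀ a ∈ Uᗮ, (∀ u v, ⟪a, q u - q v⟫ = 0) → a = 0

variable [FiniteDimensional ℝ H]

/-- If two families of vectors `x`, `y` in `W` satisfy `⟪x i, y j⟫ + ⟪y i, x j⟫ = 0` and only `0` is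
orthogonal to all `x i`, then `y` is the image of `x` under a skew-adjoint map. -/
theorem exists_skewEnd_apply_eq {ι W : Type*} [Fintype ι] [NormedAddCommGroup W]
    [InnerProductSpace ℝ W] [FiniteDimensional ℝ W] {x y : ι → W}
    (hx : ∀ a, (∀ i, ⟪a, x i⟫ = 0) → a = 0) (hxy : ∀ i j, ⟪x i, y j⟫ + ⟪y i, x j⟫ = 0) :
    ∃ S ∈ skewEnd W, ∀ i, S (x i) = y i := by
  classical
  let T : (ι → ℝ) →ₗ[ℝ] W := Fintype.linearCombination ℝ x
  let Y : (ι → ℝ) →ₗ[ℝ] W := Fintype.linearCombination ℝ y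
  have hT : T.range = ⊤ := by
    rw [← Submodule.orthogonal_eq_bot_iff, Submodule.eq_bot_iff]
    intro a ha
    refine hx a fun i => ?_
    have : x i ∈ T.range := ⟨Pi.single i 1, by simp [T, Fintype.linearCombination_apply_single]⟩
    rw [real_inner_comm]
    exact ha _ this
  have hTY : ∀ c c', ⟪T c, Y c'⟫ + ⟪Y c, T c'⟫ = 0 := by
    intro c c'
    simp only [T, Y, Fintype.linearCombination_apply, sum_inner, inner_sum, real_inner_smul_left,
      real_inner_smul_right, ← Finset.sum_add_distrib, ← mul_add, hxy, mul_zero,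
      Finset.sum_const_zero]
  obtain ⟨R, hR⟩ := LinearMap.exists_rightInverse_of_surjective T hT
  have hR' : ∀ z, T (R z) = z := fun z => LinearMap.congr_fun hR z
  refine ⟨Y ∘ₗ R, fun z z' => ?_, fun i => ?_⟩
  · have := hTY (R z) (R z')
    rw [hR', hR'] at this
    rw [add_comm]
    exact this
  -- The map `Y ∘ R` does not depend on the chosen section because `Y` kills the kernel of `T`:
  -- pairing with a preimage of `Y c` gives `⟪Y c, Y c⟫ = 0`.
  · have hker : ∀ c, T c = 0 → Y c = 0 := by
      intro c hc
      have h1 := hTY c (R (Y c))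
      rw [hc, inner_zero_left, zero_add, hR'] at h1
      exact inner_self_eq_zero.1 h1
    have h2 := hker (R (x i) - Pi.single i 1) (by
      rw [map_sub, hR']
      simp [T, Fintype.linearCombination_apply_single])
    rw [map_sub, sub_eq_zero] at h2
    rw [LinearMap.comp_apply, h2]
    simp [Y, Fintype.linearCombination_apply_single]

/-- In the nondegenerate case every such velocity is uniquely a translation plus a skew-adjoint map
of `Uᗮ` applied to the `Uᗮ`-components of the points. -/
theorem finrank_infinitesimalCongruences_of_spansModulo [Fintype V] [Nonempty V]
    (U : Submodule ℝ H) {q : V → H} (hq : SpansModulo U q) :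
    Module.finrank ℝ (infinitesimalCongruences U q) =
      Module.finrank ℝ H + Module.finrank ℝ (skewEnd Uᗮ) := by
  obtain ⟨v₀⟩ := ‹Nonempty V›
  let x : V → Uᗮ := fun v => Uᗮ.orthogonalProjectionOnto (q v)
  have hx : ∀ (a : Uᗮ) u v, ⟪(a : H), q u - q v⟫ = ⟪a, x u - x v⟫ := fun a u v => by
    rw [← map_sub, Submodule.inner_orthogonalProjectionOnto_eq_of_mem_left]
  let Θ : H × skewEnd Uᗮ →ₗ[ℝ] (V → H) := LinearMap.pi fun v =>
    LinearMap.fst ℝ _ _ + Uᗮ.subtype ∘ₗ (LinearMap.applyₗ (x v)) ∘ₗ (skewEnd Uᗮ).subtype ∘ₗ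
      LinearMap.snd ℝ _ _
  have hΘ : ∀ t S v, Θ (t, S) v = t + (S.1 (x v) : H) := fun t S v => rfl
  have hinj : Θ.ker = ⊥ := by
    refine LinearMap.ker_eq_bot'.2 ?_
    rintro ⟨t, S⟩ h
    have h1 : ∀ v, t + (S.1 (x v) : H) = 0 := fun v => by rw [← hΘ, h]; rfl
    have h2 : ∀ u v, S.1 (x u - x v) = 0 := by
      intro u v
      rw [map_sub, sub_eq_zero]
      exact Subtype.ext (add_left_cancel ((h1 u).trans (h1 v).symm))
    have h3 : S = 0 := by
      refine Subtype.ext (LinearMap.ext fun z => Subtype.ext ?_)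
      refine hq _ (S.1 z).2 fun u v => ?_
      rw [hx]
      have := S.2 z (x u - x v)
      rw [h2, inner_zero_right, add_zero] at this
      exact this
    subst h3
    have := h1 v₀
    simp only [ZeroMemClass.coe_zero, LinearMap.zero_apply, add_zero] at this
    rw [this]
    rfl
  have hrange : Θ.range = infinitesimalCongruences U q := by
    refine le_antisymm ?_ ?_
    · rintro _ ⟨⟨t, S⟩, rfl⟩ u v
      have h1 : Θ (t, S) u - Θ (t, S) v = (S.1 (x u - x v) : H) := by
        rw [hΘ, hΘ, map_sub, Submodule.coe_sub]
        abel
      rw [h1, real_inner_comm, hx, inner_skewEnd_apply_self S.2]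
      exact ⟨rfl, (S.1 (x u - x v)).2⟩
    · intro w hw
      let y : V → Uᗮ := fun v => ⟨w v - w v₀, (hw v v₀).2⟩
      have hy : ∀ u v, ((y u - y v : Uᗮ) : H) = w u - w v := by
        intro u v
        simp [y]
      have hxy : ∀ u v, ⟪y u - y v, x u - x v⟫ = 0 := by
        intro u v
        rw [← hx, hy, real_inner_comm]
        exact (hw u v).1
      have hy₀ : y v₀ = 0 := Subtype.ext (by simp [y])
      -- Polarizing the orthogonality relations at the base point `v₀` gives the bilinear relation
      -- required for a skew-adjoint map.
      obtain ⟨S, hS, hSx⟩ := exists_skewEnd_apply_eq (x := fun v => x v - x v₀) (y := y)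
        (fun a ha => by
          refine Subtype.ext (hq a a.2 fun u v => ?_)
          have h1 := ha u
          have h2 := ha v
          rw [hx, ← sub_sub_sub_cancel_right (x u) (x v) (x v₀), inner_sub_right, h1, h2, sub_zero])
        (fun u v => by
          have h1 := hxy u v
          have h2 := hxy u v₀
          have h3 := hxy v v₀
          rw [hy₀, sub_zero] at h2 h3
          rw [← sub_sub_sub_cancel_right (x u) (x v) (x v₀), inner_sub_right, inner_sub_left,
            inner_sub_left, h2, h3] at h1
          rw [real_inner_comm (y v)]
          linarith)
      refine ⟨(w v₀ - (S (x v₀) : H), ⟨S, hS⟩), funext fun v => ?_⟩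
      have h4 : (S (x v) : H) - S (x v₀) = w v - w v₀ := by
        have := congrArg (Subtype.val) (hSx v)
        rw [map_sub, Submodule.coe_sub] at this
        exact this
      rw [hΘ]
      change w v₀ - (S (x v₀) : H) + (S (x v) : H) = w v
      rw [sub_add_eq_add_sub, add_sub_assoc, h4]
      abel
  rw [← hrange, LinearMap.finrank_range_of_inj (LinearMap.ker_eq_bot.1 hinj), Module.finrank_prod]

set_option maxHeartbeats 1000000 in
-- If the differences of the points miss the directions `Q ≠ 0` in `Uᗮ`, each point may also move
-- freely in `Q`. This adds `|V| * dim Q` parameters, of which at most `dim Q * dim Uᗮ` are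
-- redundant, so the gain is at least `2 * dim Q`. A gap of two rather than one is what later
-- excludes degenerate points on a curve.
theorem add_two_le_finrank_infinitesimalCongruences [Fintype V]
    (U : Submodule ℝ H) {q : V → H} (hq : ¬ SpansModulo U q)
    (hV : Module.finrank ℝ Uᗮ + 2 ≤ Fintype.card V) :
    Module.finrank ℝ H + Module.finrank ℝ (skewEnd Uᗮ) + 2 ≤
      Module.finrank ℝ (infinitesimalCongruences U q) := by
  have hne : 0 < Fintype.card V := by omega
  obtain ⟨v₀⟩ := Fintype.card_pos_iff.1 hne
  let x : V → Uᗮ := fun v => Uᗮ.orthogonalProjectionOnto (q v)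
  have hx : ∀ (a : Uᗮ) u v, ⟪(a : H), q u - q v⟫ = ⟪a, x u - x v⟫ := fun a u v => by
    rw [← map_sub, Submodule.inner_orthogonalProjectionOnto_eq_of_mem_left]
  let Q : Submodule ℝ Uᗮ := (Submodule.span ℝ (Set.range fun uv : V × V => x uv.1 - x uv.2))ᗮ
  have hQ : ∀ a, a ∈ Q ↔ ∀ u v, ⟪a, x u - x v⟫ = 0 := by
    intro a
    rw [Submodule.mem_orthogonal']
    constructor
    · intro h u v
      exact h _ (Submodule.subset_span ⟨(u, v), rfl⟩)
    · intro h z hz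
      induction hz using Submodule.span_induction with
      | mem z hz => obtain ⟨⟨u, v⟩, rfl⟩ := hz; exact h u v
      | zero => exact inner_zero_right _
      | add z z' _ _ h1 h2 => rw [inner_add_right, h1, h2, add_zero]
      | smul c z _ h1 => rw [real_inner_smul_right, h1, mul_zero]
  have hQpos : 0 < Module.finrank ℝ Q := by
    unfold SpansModulo at hq
    push Not at hq
    obtain ⟨a, haU, ha, ha0⟩ := hq
    refine Module.finrank_pos_iff_exists_ne_zero.2
      ⟨⟨⟨a, haU⟩, (hQ _).2 fun u v => by rw [← hx]; exact ha u v⟩, fun h => ha0 ?_⟩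
    exact congrArg (fun z : Q => ((z : Uᗮ) : H)) h
  let Θ : H × skewEnd Uᗮ × (V → Q) →ₗ[ℝ] (V → H) := LinearMap.pi fun v =>
    LinearMap.fst ℝ _ _ + Uᗮ.subtype ∘ₗ ((LinearMap.applyₗ (x v)) ∘ₗ (skewEnd Uᗮ).subtype ∘ₗ
      LinearMap.fst ℝ _ _ ∘ₗ LinearMap.snd ℝ _ _ +
      Q.subtype ∘ₗ LinearMap.proj v ∘ₗ LinearMap.snd ℝ _ _ ∘ₗ LinearMap.snd ℝ _ _)
  have hΘ : ∀ t S c v, Θ (t, S, c) v = t + ((S.1 (x v) + c v : Uᗮ) : H) := fun t S c v => rfl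
  have hrange : Θ.range ≤ infinitesimalCongruences U q := by
    rintro _ ⟨⟨t, S, c⟩, rfl⟩ u v
    have h1 : Θ (t, S, c) u - Θ (t, S, c) v = ((S.1 (x u - x v) + (c u - c v) : Uᗮ) : H) := by
      rw [hΘ, hΘ, map_sub, add_sub_add_left_eq_sub, ← Submodule.coe_sub]
      congr 1
      abel
    rw [h1, real_inner_comm, hx, inner_add_left, inner_skewEnd_apply_self S.2, zero_add, inner_sub_left,
      (hQ _).1 (c u).2, (hQ _).1 (c v).2, sub_zero]
    exact ⟨rfl, SetLike.coe_mem _⟩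
  let b := stdOrthonormalBasis ℝ Q
  -- As `S b_i` is orthogonal to `b_i`, this sum records both `S` on `Q` and `c v₀`. Recording them
  -- separately would cost another `dim Q` and only give a gap of one.
  let Λ : H × skewEnd Uᗮ × (V → Q) →ₗ[ℝ] (Fin (Module.finrank ℝ Q) → Uᗮ) := LinearMap.pi fun i =>
    (LinearMap.applyₗ (b i : Uᗮ)) ∘ₗ (skewEnd Uᗮ).subtype ∘ₗ LinearMap.fst ℝ _ _ ∘ₗ
      LinearMap.snd ℝ _ _ + (LinearMap.toSpanSingleton ℝ Uᗮ (b i : Uᗮ)) ∘ₗ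
      (innerₛₗ ℝ (b i)) ∘ₗ LinearMap.proj v₀ ∘ₗ LinearMap.snd ℝ _ _ ∘ₗ LinearMap.snd ℝ _ _
  have hΛ : ∀ t S c i, Λ (t, S, c) i = S.1 (b i : Uᗮ) + ⟪b i, c v₀⟫ • (b i : Uᗮ) :=
    fun t S c i => rfl
  have hinj : Disjoint Θ.ker Λ.ker := by
    rw [Submodule.disjoint_def]
    rintro ⟨t, S, c⟩ h1 h2
    have h1' : ∀ v, t + ((S.1 (x v) + c v : Uᗮ) : H) = 0 := fun v => by
      rw [← hΘ, LinearMap.mem_ker.1 h1]; rfl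
    have h2' : ∀ i, S.1 (b i : Uᗮ) + ⟪b i, c v₀⟫ • (b i : Uᗮ) = 0 := fun i => by
      rw [← hΛ t, LinearMap.mem_ker.1 h2]; rfl
    have h3 : ∀ i, ⟪b i, c v₀⟫ = 0 := by
      intro i
      have := congrArg (fun z => ⟪z, (b i : Uᗮ)⟫) (h2' i)
      simp only [inner_add_left, inner_skewEnd_apply_self S.2, real_inner_smul_left, inner_zero_left, zero_add,
        ← Submodule.coe_inner, b.inner_eq_one, mul_one] at this
      exact this
    have hc0 : c v₀ = 0 := by
      refine b.repr.injective (PiLp.ext fun i => ?_)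
      rw [b.repr_apply_apply, h3, map_zero]
      rfl
    have hSb : ∀ i, S.1 (b i : Uᗮ) = 0 := fun i => by
      have := h2' i
      rwa [h3, zero_smul, add_zero] at this
    have hSQ : ∀ z ∈ Q, S.1 z = 0 := by
      intro z hz
      have : S.1 ∘ₗ Q.subtype = 0 := b.toBasis.ext fun i => by simpa using hSb i
      exact LinearMap.congr_fun this ⟨z, hz⟩
    have hSx : ∀ u v, S.1 (x u - x v) = 0 := by
      intro u v
      have h4 : S.1 (x u - x v) = ((c v - c u : Q) : Uᗮ) := by
        have := add_left_cancel ((h1' u).trans (h1' v).symm)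
        have := Subtype.ext this
        rw [map_sub, Submodule.coe_sub, sub_eq_sub_iff_add_eq_add, add_comm _ (S.1 (x v))]
        exact this
      -- The image of a difference lies in `Q`, where `S` vanishes, so skewness makes its norm zero.
      have h5 : ⟪S.1 (x u - x v), S.1 (x u - x v)⟫ = 0 := by
        have := S.2 (x u - x v) (S.1 (x u - x v))
        rw [hSQ (S.1 (x u - x v)) (by rw [h4]; exact SetLike.coe_mem _), inner_zero_right,
          add_zero] at this
        exact this
      exact inner_self_eq_zero.1 h5
    have hS : S = 0 := by
      refine Subtype.ext (LinearMap.ext fun z => ?_)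
      have h6 : S.1 z ∈ Q := (hQ _).2 fun u v => by
        have := S.2 z (x u - x v)
        rw [hSx, inner_zero_right, add_zero] at this
        exact this
      have h7 := S.2 z (S.1 z)
      rw [hSQ _ h6, inner_zero_right, add_zero] at h7
      exact inner_self_eq_zero.1 h7
    subst hS
    have ht : t = 0 := by simpa [hc0] using h1' v₀
    subst ht
    have hc : c = 0 := funext fun v => by
      have := h1' v
      simpa using this
    rw [hc]
    rfl
  have hker : Module.finrank ℝ Θ.ker ≤ Module.finrank ℝ Q * Module.finrank ℝ Uᗮ := by
    have h1 := finrank_ker_le_of_disjoint hinj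
    rwa [Module.finrank_pi_fintype, Finset.sum_const, Finset.card_univ, Fintype.card_fin,
      smul_eq_mul] at h1
  have h1 := LinearMap.finrank_range_add_finrank_ker Θ
  rw [Module.finrank_prod, Module.finrank_prod, Module.finrank_pi_fintype, Finset.sum_const,
    Finset.card_univ, smul_eq_mul] at h1
  have h2 := Submodule.finrank_mono hrange
  have h3 : Module.finrank ℝ Q * (Module.finrank ℝ Uᗮ + 2) ≤
    Fintype.card V * Module.finrank ℝ Q := by
    rw [mul_comm (Fintype.card V)]
    exact Nat.mul_le_mul_left _ hV
  have h4 : Module.finrank ℝ Q * (Module.finrank ℝ Uᗮ + 2) =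
    Module.finrank ℝ Q * Module.finrank ℝ Uᗮ + 2 * Module.finrank ℝ Q := by ring
  omega

end Congruences

/-! ### Compact curves: no single boundary point -/

open Set Filter Topology

/-- By injectivity the image is the open set `θ '' S` minus the compact image of `Icc a b \ U`. So
subarcs of open arcs are open. -/
theorem isOpen_image_of_isOpen_image_Ioo {Y : Type*} [TopologicalSpace Y] [T2Space Y] {θ : ℝ → Y}
    {a b : ℝ} (hθ : ContinuousOn θ (Icc a b)) (hinj : InjOn θ (Icc a b)) {S U : Set ℝ}
    (hS : S ⊆ Icc a b) (hopen : IsOpen (θ '' S)) (hU : IsOpen U) : IsOpen (θ '' (S ∩ U)) := by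
  have h1 : IsClosed (θ '' (Icc a b \ U)) :=
    ((isCompact_Icc.diff hU).image_of_continuousOn (hθ.mono sdiff_subset)).isClosed
  have h2 : θ '' (S ∩ U) = θ '' S \ θ '' (Icc a b \ U) := by
    ext y
    constructor
    · rintro ⟨x, ⟨hxS, hxU⟩, rfl⟩
      refine ⟨⟨x, hxS, rfl⟩, ?_⟩
      rintro ⟨z, ⟨hz, hzU⟩, hzx⟩
      exact hzU (hinj hz (hS hxS) hzx ▸ hxU)
    · rintro ⟨⟨x, hxS, rfl⟩, hx⟩
      refine ⟨x, ⟨hxS, ?_⟩, rfl⟩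
      by_contra hxU
      exact hx ⟨x, ⟨hS hxS, hxU⟩, rfl⟩
  rw [h2]
  exact hopen.sdiff h1

/-- `θ` parametrizes an open arc of length `2ε` around `y`. -/
structure IsArcAt {Y : Type*} [TopologicalSpace Y] (θ : ℝ → Y) (ε : ℝ) (y : Y) : Prop where
  pos : 0 < ε
  cont : ContinuousOn θ (Icc (-ε) ε)
  inj : InjOn θ (Icc (-ε) ε)
  apply_zero : θ 0 = y
  isOpen : IsOpen (θ '' Ioo (-ε) ε)

/-- `θ` parametrizes a half-open arc of length `ε` ending at `y`. -/
structure IsHalfArcAt {Y : Type*} [TopologicalSpace Y] (θ : ℝ → Y) (ε : ℝ) (y : Y) : Prop where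
  pos : 0 < ε
  cont : ContinuousOn θ (Icc (-ε) 0)
  inj : InjOn θ (Icc (-ε) 0)
  apply_zero : θ 0 = y
  isOpen : IsOpen (θ '' Ioc (-ε) 0)

namespace IsArcAt

variable {Y : Type*} [TopologicalSpace Y] {θ : ℝ → Y} {ε : ℝ} {y : Y}

theorem neg (h : IsArcAt θ ε y) : IsArcAt (fun t => θ (-t)) ε y where
  pos := h.pos
  cont := h.cont.comp continuousOn_neg fun t ht => ⟨neg_le_neg ht.2, neg_le.1 ht.1⟩
  inj := fun s hs t ht hst => neg_injective
    (h.inj ⟨neg_le_neg hs.2, neg_le.1 hs.1⟩ ⟨neg_le_neg ht.2, neg_le.1 ht.1⟩ hst)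
  apply_zero := by simpa using h.apply_zero
  isOpen := by
    have : (fun t => θ (-t)) '' Ioo (-ε) ε = θ '' Ioo (-ε) ε := by
      rw [show (fun t => θ (-t)) = θ ∘ Neg.neg from rfl, image_comp]
      simp
    rw [this]
    exact h.isOpen

theorem isOpen_image_Ioo [T2Space Y] (h : IsArcAt θ ε y) {a b : ℝ} (ha : -ε ≤ a) (hb : b ≤ ε) :
    IsOpen (θ '' Ioo a b) := by
  have := isOpen_image_of_isOpen_image_Ioo h.cont h.inj Ioo_subset_Icc_self h.isOpen
    (isOpen_Ioo (a := a) (b := b))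
  rwa [inter_eq_right.2 (Ioo_subset_Ioo ha hb)] at this

theorem exists_isArcAt_subset [T2Space Y] (h : IsArcAt θ ε y) {N : Set Y} (hN : N ∈ 𝓝 y) :
    ∃ δ, IsArcAt θ δ y ∧ θ '' Icc (-δ) δ ⊆ N := by
  have h0 : (0 : ℝ) ∈ Ioo (-ε) ε := ⟨neg_lt_zero.2 h.pos, h.pos⟩
  have hc : ContinuousAt θ 0 := h.cont.continuousAt (Icc_mem_nhds h0.1 h0.2)
  rw [← h.apply_zero] at hN
  obtain ⟨δ, hδ, hsub⟩ := Metric.nhds_basis_closedBall.mem_iff.1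
    (inter_mem (hc hN) (Icc_mem_nhds h0.1 h0.2))
  rw [Real.closedBall_eq_Icc, zero_sub, zero_add] at hsub
  have hsub' : Icc (-δ) δ ⊆ Icc (-ε) ε := fun t ht => (hsub ht).2
  have h1 := hsub' ⟨le_refl _, by linarith⟩
  have h2 := hsub' ⟨by linarith, le_refl _⟩
  refine ⟨δ, ⟨hδ, h.cont.mono hsub', h.inj.mono hsub', h.apply_zero,
    h.isOpen_image_Ioo h1.1 h2.2⟩, ?_⟩
  rintro _ ⟨t, ht, rfl⟩
  exact (hsub ht).1

theorem image_mem_nhds (h : IsArcAt θ ε y) : θ '' Ioo (-ε) ε ∈ 𝓝 y :=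
  h.isOpen.mem_nhds ⟨0, ⟨neg_lt_zero.2 h.pos, h.pos⟩, h.apply_zero⟩

theorem isPreconnected_image (h : IsArcAt θ ε y) {S : Set ℝ} (hS : S ⊆ Icc (-ε) ε)
    (hS' : IsPreconnected S) : IsPreconnected (θ '' S) :=
  hS'.image θ (h.cont.mono hS)

end IsArcAt

/-- `Ω` is an open connected set containing `y₀` with exactly one, one-sided, end. -/
structure IsOpenSegment {Y : Type*} [TopologicalSpace Y] (y₀ y : Y) (Ω : Set Y) : Prop where
  isOpen : IsOpen Ω
  conn : IsPreconnected Ω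
  mem : y₀ ∈ Ω
  frontier_eq : frontier Ω = {y}
  notMem : y ∉ interior (closure Ω)

/-- Otherwise the interior of `Ω` and the complement of its closure would separate `S`. With a
one-point frontier, this traps the end of a segment inside any connected set that straddles it. -/
theorem IsPreconnected.inter_frontier_nonempty' {Y : Type*} [TopologicalSpace Y] {S Ω : Set Y}
    (hS : IsPreconnected S) (h1 : (S ∩ Ω).Nonempty) (h2 : ¬ S ⊆ Ω) :
    (S ∩ frontier Ω).Nonempty := by
  by_contra h
  rw [not_nonempty_iff_eq_empty] at h
  have hcl : S ∩ closure Ω ⊆ interior Ω := by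
    intro x hx
    by_contra hxi
    exact (h ▸ (⟨hx.1, hx.2, hxi⟩ : x ∈ S ∩ frontier Ω) : x ∈ (∅ : Set Y))
  have := hS.subset_left_of_subset_union isOpen_interior isClosed_closure.isOpen_compl
    (disjoint_compl_right.mono_left (interior_subset.trans subset_closure))
    (fun x hx => (em (x ∈ closure Ω)).imp (fun hc => hcl ⟨hx, hc⟩) id)
    (h1.mono fun x hx => ⟨hx.1, hcl ⟨hx.1, subset_closure hx.2⟩⟩)
  exact h2 (this.trans interior_subset)

namespace IsOpenSegment

variable {Y : Type*} [TopologicalSpace Y] {y₀ y : Y} {Ω : Set Y}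

theorem end_notMem (h : IsOpenSegment y₀ y Ω) : y ∉ Ω := by
  have : y ∈ frontier Ω := h.frontier_eq ▸ rfl
  rw [h.isOpen.frontier_eq] at this
  exact this.2

theorem closure_eq (h : IsOpenSegment y₀ y Ω) : closure Ω = insert y Ω := by
  rw [closure_eq_self_union_frontier, h.frontier_eq, union_singleton]

/-- A one-sided end can be pushed further along an arc. -/
theorem exists_ssuperset [T2Space Y] (h : IsOpenSegment y₀ y Ω) {θ : ℝ → Y} {ε : ℝ}
    (hθ : IsArcAt θ ε y) : ∃ y' Ω', IsOpenSegment y₀ y' Ω' ∧ Ω ⊂ Ω' := by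
  have hε := hθ.pos
  have h0 : (0 : ℝ) ∈ Icc (-ε) ε := ⟨by linarith, by linarith⟩
  -- A piece of the arc avoiding `y`, the only frontier point of `Ω`, cannot cross from `Ω` to its
  -- complement.
  have side : ∀ S ⊆ Icc (-ε) ε, 0 ∉ S → IsPreconnected S →
      θ '' S ⊆ Ω ∨ Disjoint (θ '' S) Ω := by
    intro S hS hS0 hSc
    by_contra hcon
    push Not at hcon
    obtain ⟨x, ⟨t, ht, rfl⟩, hx⟩ := (hθ.isPreconnected_image hS hSc).inter_frontier_nonempty'
      (not_disjoint_iff_nonempty_inter.1 hcon.2) hcon.1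
    rw [h.frontier_eq, mem_singleton_iff, ← hθ.apply_zero] at hx
    exact hS0 (hθ.inj (hS ht) h0 hx ▸ ht)
  have hL : Ioo (-ε) 0 ⊆ Icc (-ε) ε := fun t ht => ⟨ht.1.le, by linarith [ht.2]⟩
  have hR : Ioo 0 ε ⊆ Icc (-ε) ε := fun t ht => ⟨by linarith [ht.1], ht.2.le⟩
  -- after reversing the arc, `Ω` contains its left half and misses its right half
  obtain ⟨θ, hθ, hleft, hright⟩ : ∃ θ : ℝ → Y, IsArcAt θ ε y ∧ θ '' Ioo (-ε) 0 ⊆ Ω ∧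
      Disjoint (θ '' Ioo 0 ε) Ω := by
    rcases side _ hL (by simp) isPreconnected_Ioo with h1 | h1 <;>
    rcases side _ hR (by simp) isPreconnected_Ioo with h2 | h2
    -- With both halves in `Ω`, its closure would be a neighbourhood of `y`, contrary to
    -- one-sidedness.
    · refine absurd (mem_interior_iff_mem_nhds.2 (mem_of_superset hθ.image_mem_nhds ?_)) h.notMem
      rintro _ ⟨t, ht, rfl⟩
      rcases lt_trichotomy t 0 with h3 | h3 | h3
      · exact subset_closure (h1 ⟨t, ⟨ht.1, h3⟩, rfl⟩)
      · rw [h3, hθ.apply_zero, h.closure_eq]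
        exact mem_insert _ _
      · exact subset_closure (h2 ⟨t, ⟨h3, ht.2⟩, rfl⟩)
    · exact ⟨θ, hθ, h1, h2⟩
    · refine ⟨fun t => θ (-t), hθ.neg, ?_, ?_⟩
      · rw [show (fun t => θ (-t)) = θ ∘ Neg.neg from rfl, image_comp]
        simpa using h2
      · rw [show (fun t => θ (-t)) = θ ∘ Neg.neg from rfl, image_comp]
        simpa using h1
    · have : y ∈ closure Ω := h.closure_eq ▸ mem_insert _ _
      obtain ⟨_, ⟨t, ht, rfl⟩, hx⟩ := mem_closure_iff_nhds.1 this _ hθ.image_mem_nhds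
      rcases lt_trichotomy t 0 with h3 | h3 | h3
      · exact absurd hx (disjoint_left.1 h1 ⟨t, ⟨ht.1, h3⟩, rfl⟩)
      · rw [h3, hθ.apply_zero] at hx
        exact absurd hx h.end_notMem
      · exact absurd hx (disjoint_left.1 h2 ⟨t, ⟨h3, ht.2⟩, rfl⟩)
  -- Only half of the arc is added: the unused points between `ε / 2` and `ε` show that the new end
  -- is again one-sided.
  have hsub : Icc (-(ε / 2)) (ε / 2) ⊆ Icc (-ε) ε := fun t ht =>
    ⟨by linarith [ht.1], by linarith [ht.2]⟩
  have hm : ε / 2 ∈ Icc (-ε) ε := ⟨by linarith, by linarith⟩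
  set A := θ '' Ioo (-(ε / 2)) (ε / 2) with hA
  have hAcl : closure A ⊆ θ '' Icc (-(ε / 2)) (ε / 2) :=
    closure_minimal (image_mono Ioo_subset_Icc_self)
      (isCompact_Icc.image_of_continuousOn (hθ.cont.mono hsub)).isClosed
  have hmem : ∀ t ∈ Ico (ε / 2) ε, θ t ∉ Ω ∪ A := by
    rintro t ht (h1 | ⟨s, hs, hst⟩)
    · exact disjoint_left.1 hright ⟨t, ⟨by linarith [ht.1], ht.2⟩, rfl⟩ h1
    · have := hθ.inj (hsub (Ioo_subset_Icc_self hs)) ⟨by linarith [ht.1], ht.2.le⟩ hst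
      linarith [hs.2, ht.1]
  have hyA : y ∈ A := ⟨0, ⟨by linarith, by linarith⟩, hθ.apply_zero⟩
  have hopenA : IsOpen A := hθ.isOpen_image_Ioo (by linarith) (by linarith)
  have hend : θ (ε / 2) ∈ closure (Ω ∪ A) := by
    have h1 : ContinuousWithinAt θ (Ioo (-(ε / 2)) (ε / 2)) (ε / 2) :=
      (hθ.cont _ hm).mono (Ioo_subset_Icc_self.trans hsub)
    refine closure_mono subset_union_right (h1.mem_closure_image ?_)
    rw [closure_Ioo (by linarith)]
    exact ⟨by linarith, le_refl _⟩
  have hcl : closure (Ω ∪ A) ⊆ insert (θ (ε / 2)) (Ω ∪ A) := by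
    rw [closure_union, h.closure_eq]
    rintro x ((rfl | hx) | hx)
    · exact Or.inr (Or.inr hyA)
    · exact Or.inr (Or.inl hx)
    · obtain ⟨t, ht, rfl⟩ := hAcl hx
      rcases eq_or_lt_of_le ht.2 with h1 | h1
      · exact Or.inl (h1 ▸ rfl)
      · rcases eq_or_lt_of_le ht.1 with h2 | h2
        · exact Or.inr (Or.inl (hleft ⟨t, ⟨by linarith, by linarith⟩, rfl⟩))
        · exact Or.inr (Or.inr ⟨t, ⟨h2, h1⟩, rfl⟩)
  refine ⟨θ (ε / 2), Ω ∪ A, ⟨h.isOpen.union hopenA, ?_, Or.inl h.mem, ?_, ?_⟩, ?_⟩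
  · refine h.conn.union' ⟨θ (-(ε / 4)), hleft ⟨_, ⟨by linarith, by linarith⟩, rfl⟩,
      ⟨_, ⟨by linarith, by linarith⟩, rfl⟩⟩
      (hθ.isPreconnected_image (Ioo_subset_Icc_self.trans hsub) isPreconnected_Ioo)
  · rw [(h.isOpen.union hopenA).frontier_eq]
    refine Subset.antisymm ?_ ?_
    · rintro x ⟨hx, hx'⟩
      exact (hcl hx).resolve_right hx'
    · rintro _ rfl
      exact ⟨hend, hmem _ ⟨le_refl _, by linarith⟩⟩
  · intro hnhds
    have h1 : ContinuousWithinAt θ (Ioo (ε / 2) ε) (ε / 2) :=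
      (hθ.cont _ hm).mono fun t ht => ⟨by linarith [ht.1], ht.2.le⟩
    have h2 : θ (ε / 2) ∈ closure (θ '' Ioo (ε / 2) ε) := by
      refine h1.mem_closure_image ?_
      rw [closure_Ioo (by linarith)]
      exact ⟨le_refl _, by linarith⟩
    obtain ⟨_, hx, t, ht, rfl⟩ := mem_closure_iff.1 h2 _ isOpen_interior hnhds
    rcases hcl (interior_subset hx) with h3 | h3
    · have := hθ.inj ⟨by linarith [ht.1], ht.2.le⟩ hm h3
      linarith [ht.1]
    · exact hmem t ⟨ht.1.le, ht.2⟩ h3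
  · exact ⟨subset_union_left, fun hss => h.end_notMem (hss (Or.inr hyA))⟩

end IsOpenSegment

/-- A half-open arc contains an open segment. -/
theorem IsHalfArcAt.exists_isOpenSegment {Y : Type*} [TopologicalSpace Y] [T2Space Y] {θ : ℝ → Y}
    {ε : ℝ} {y₀ : Y} (h : IsHalfArcAt θ ε y₀) : ∃ y Ω, IsOpenSegment y₀ y Ω := by
  have hε := h.pos
  -- Again half of the arc is kept in reserve, to witness one-sidedness at the end `θ (-(ε / 2))`.
  have hm : -(ε / 2) ∈ Icc (-ε) 0 := ⟨by linarith, by linarith⟩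
  have hsub : Ioc (-(ε / 2)) 0 ⊆ Icc (-ε) 0 := fun t ht => ⟨by linarith [ht.1], ht.2⟩
  have hsub' : Icc (-(ε / 2)) 0 ⊆ Icc (-ε) 0 := fun t ht => ⟨by linarith [ht.1], ht.2⟩
  set A := θ '' Ioc (-(ε / 2)) 0 with hA
  have hopen : IsOpen A := by
    have := isOpen_image_of_isOpen_image_Ioo h.cont h.inj Ioc_subset_Icc_self h.isOpen
      (isOpen_Ioi (a := -(ε / 2)))
    rwa [Ioc_inter_Ioi, sup_of_le_right (by linarith)] at this
  have hcl : closure A ⊆ insert (θ (-(ε / 2))) A := by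
    have h1 : closure A ⊆ θ '' Icc (-(ε / 2)) 0 := closure_minimal (image_mono Ioc_subset_Icc_self)
      (isCompact_Icc.image_of_continuousOn (h.cont.mono hsub')).isClosed
    intro x hx
    obtain ⟨t, ht, rfl⟩ := h1 hx
    rcases eq_or_lt_of_le ht.1 with h2 | h2
    · exact Or.inl (h2 ▸ rfl)
    · exact Or.inr ⟨t, ⟨h2, ht.2⟩, rfl⟩
  have hmem : ∀ t ∈ Ioc (-ε) (-(ε / 2)), θ t ∉ A := by
    rintro t ht ⟨s, hs, hst⟩
    have := h.inj (hsub hs) ⟨ht.1.le, by linarith [ht.2]⟩ hst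
    linarith [hs.1, ht.2]
  refine ⟨θ (-(ε / 2)), A, hopen, isPreconnected_Ioc.image θ (h.cont.mono hsub),
    ⟨0, ⟨by linarith, le_refl _⟩, h.apply_zero⟩, ?_, ?_⟩
  · rw [hopen.frontier_eq]
    refine Subset.antisymm ?_ ?_
    · rintro x ⟨hx, hx'⟩
      exact (hcl hx).resolve_right hx'
    · rintro _ rfl
      refine ⟨((h.cont _ hm).mono hsub).mem_closure_image ?_, hmem _ ⟨by linarith, le_refl _⟩⟩
      rw [closure_Ioc (by linarith)]
      exact ⟨le_refl _, by linarith⟩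
  · intro hnhds
    have h1 : ContinuousWithinAt θ (Ioo (-ε) (-(ε / 2))) (-(ε / 2)) :=
      (h.cont _ hm).mono fun t ht => ⟨ht.1.le, by linarith [ht.2]⟩
    have h2 : θ (-(ε / 2)) ∈ closure (θ '' Ioo (-ε) (-(ε / 2))) := by
      refine h1.mem_closure_image ?_
      rw [closure_Ioo (by linarith)]
      exact ⟨by linarith, le_refl _⟩
    obtain ⟨_, hx, t, ht, rfl⟩ := mem_closure_iff.1 h2 _ isOpen_interior hnhds
    rcases hcl (interior_subset hx) with h3 | h3
    · have := h.inj ⟨ht.1.le, by linarith [ht.2]⟩ hm h3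
      linarith [ht.2]
    · exact hmem t ⟨ht.1, ht.2.le⟩ h3

/-- The union of a chain of open segments in a compact space of arcs is an open segment. -/
theorem IsOpenSegment.sUnion_of_isChain {Y : Type*} [TopologicalSpace Y] [T2Space Y]
    [CompactSpace Y] {y₀ : Y} (harc : ∀ y ≠ y₀, ∃ θ ε, IsArcAt θ ε y) {c : Set (Set Y)}
    (hc : ∀ Ω ∈ c, ∃ y, IsOpenSegment y₀ y Ω) (hchain : IsChain (· ⊆ ·) c) (hne : c.Nonempty) :
    ∃ y, IsOpenSegment y₀ y (⋃₀ c) := by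
  obtain ⟨Ω₀, hΩ₀⟩ := hne
  have hopen : IsOpen (⋃₀ c) := isOpen_sUnion fun Ω hΩ => (hc Ω hΩ).choose_spec.isOpen
  have hconn : IsPreconnected (⋃₀ c) := isPreconnected_sUnion y₀ c
    (fun Ω hΩ => (hc Ω hΩ).choose_spec.mem) (fun Ω hΩ => (hc Ω hΩ).choose_spec.conn)
  have hmem : y₀ ∈ ⋃₀ c := ⟨Ω₀, hΩ₀, (hc Ω₀ hΩ₀).choose_spec.mem⟩
  have hdir : DirectedOn (· ⊆ ·) c := hchain.directedOn
  have hfne : (frontier (⋃₀ c)).Nonempty := by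
    -- Without frontier the union is compact, so a single member of the chain covers it; but that
    -- member's end would then lie in the member itself.
    by_contra hemp
    rw [not_nonempty_iff_eq_empty, hopen.frontier_eq, sdiff_eq_empty] at hemp
    have hcomp : IsCompact (⋃₀ c) := (isClosed_of_closure_subset hemp).isCompact
    have : Nonempty c := ⟨⟨Ω₀, hΩ₀⟩⟩
    obtain ⟨⟨Ω, hΩ⟩, hsub⟩ := hcomp.elim_directed_cover (fun Ω : c => Ω.1)
      (fun Ω => (hc Ω.1 Ω.2).choose_spec.isOpen) sUnion_eq_iUnion.subset hdir.directed_val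
    obtain ⟨y, hy⟩ := hc Ω hΩ
    have h1 : y ∈ closure Ω := hy.closure_eq ▸ mem_insert _ _
    exact hy.end_notMem (hsub (hemp (closure_mono (subset_sUnion_of_mem hΩ) h1)))
  -- every neighbourhood of a frontier point contains the end of a large member of the chain
  have hend : ∀ z ∈ frontier (⋃₀ c), ∀ S : Set Y, IsPreconnected S → z ∈ S → ∀ Ω ∈ c,
      (S ∩ Ω).Nonempty → ∀ y, IsOpenSegment y₀ y Ω → y ∈ S := by
    intro z hz S hS hzS Ω hΩ hSΩ y hy
    rw [hopen.frontier_eq] at hz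
    obtain ⟨x, hx, hx'⟩ := hS.inter_frontier_nonempty' hSΩ
      (fun hsub => hz.2 ⟨Ω, hΩ, hsub hzS⟩)
    rw [hy.frontier_eq, mem_singleton_iff] at hx'
    exact hx' ▸ hx
  have hne₀ : ∀ z ∈ frontier (⋃₀ c), z ≠ y₀ := by
    rintro z hz rfl
    rw [hopen.frontier_eq] at hz
    exact hz.2 hmem
  obtain ⟨z, hz⟩ := hfne
  -- Two frontier points have disjoint arc neighbourhoods, and the end of a sufficiently large
  -- member would have to lie in both.
  have huniq : frontier (⋃₀ c) = {z} := by
    refine Subset.antisymm (fun z' hz' => ?_) (singleton_subset_iff.2 hz)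
    by_contra hzz
    obtain ⟨N, N', hN, hN', hd⟩ := t2_separation_nhds (Ne.symm hzz : z ≠ z')
    obtain ⟨θ, ε, hθ⟩ := harc z (hne₀ z hz)
    obtain ⟨θ', ε', hθ'⟩ := harc z' (hne₀ z' hz')
    obtain ⟨δ, hδ, hδN⟩ := hθ.exists_isArcAt_subset hN
    obtain ⟨δ', hδ', hδN'⟩ := hθ'.exists_isArcAt_subset hN'
    obtain ⟨x, hx, Ω, hΩ, hxΩ⟩ := mem_closure_iff_nhds.1 (frontier_subset_closure hz) _
      hδ.image_mem_nhds
    obtain ⟨x', hx', Ω', hΩ', hxΩ'⟩ := mem_closure_iff_nhds.1 (frontier_subset_closure hz') _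
      hδ'.image_mem_nhds
    obtain ⟨Ω₁, hΩ₁, h1, h2⟩ := hdir Ω hΩ Ω' hΩ'
    obtain ⟨y, hy⟩ := hc Ω₁ hΩ₁
    have h3 := hend z hz _ (hδ.isPreconnected_image Ioo_subset_Icc_self isPreconnected_Ioo)
      (mem_of_mem_nhds hδ.image_mem_nhds) Ω₁ hΩ₁ ⟨x, hx, h1 hxΩ⟩ y hy
    have h4 := hend z' hz' _ (hδ'.isPreconnected_image Ioo_subset_Icc_self isPreconnected_Ioo)
      (mem_of_mem_nhds hδ'.image_mem_nhds) Ω₁ hΩ₁ ⟨x', hx', h2 hxΩ'⟩ y hy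
    exact disjoint_left.1 hd (hδN (image_mono Ioo_subset_Icc_self h3))
      (hδN' (image_mono Ioo_subset_Icc_self h4))
  refine ⟨z, hopen, hconn, hmem, huniq, fun hnhds => ?_⟩
  obtain ⟨θ, ε, hθ⟩ := harc z (hne₀ z hz)
  obtain ⟨δ, hδ, hδN⟩ := hθ.exists_isArcAt_subset (mem_interior_iff_mem_nhds.1 hnhds)
  have hδpos := hδ.pos
  have h0 : (0 : ℝ) ∈ Icc (-δ) δ := ⟨by linarith, by linarith⟩
  have hin : ∀ t ∈ Icc (-δ) δ, t ≠ 0 → θ t ∈ ⋃₀ c := by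
    intro t ht ht0
    have h1 := hδN ⟨t, ht, rfl⟩
    rw [closure_eq_self_union_frontier, huniq] at h1
    refine h1.resolve_right fun h2 => ht0 (hδ.inj ht h0 ?_)
    rw [hδ.apply_zero]
    exact h2
  -- If the end `z` were two-sided, a large member would contain both endpoints of the arc. Its own
  -- end then lies on both closed halves of the arc, hence equals `z`.
  obtain ⟨Ω, hΩ, h1⟩ := hin (-δ) ⟨le_refl _, by linarith⟩ (by linarith)
  obtain ⟨Ω', hΩ', h2⟩ := hin δ ⟨by linarith, le_refl _⟩ (by linarith)
  obtain ⟨Ω₁, hΩ₁, h3, h4⟩ := hdir Ω hΩ Ω' hΩ'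
  obtain ⟨y, hy⟩ := hc Ω₁ hΩ₁
  have hsL : Icc (-δ) 0 ⊆ Icc (-δ) δ := Icc_subset_Icc_right (by linarith)
  have hsR : Icc 0 δ ⊆ Icc (-δ) δ := Icc_subset_Icc_left (by linarith)
  obtain ⟨s, hs, hsy⟩ := hend z hz _ (hδ.isPreconnected_image hsL isPreconnected_Icc)
    ⟨0, ⟨by linarith, le_refl _⟩, hδ.apply_zero⟩ Ω₁ hΩ₁
    ⟨_, ⟨-δ, ⟨le_refl _, by linarith⟩, rfl⟩, h3 h1⟩ y hy
  obtain ⟨t, ht, hty⟩ := hend z hz _ (hδ.isPreconnected_image hsR isPreconnected_Icc)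
    ⟨0, ⟨le_refl _, by linarith⟩, hδ.apply_zero⟩ Ω₁ hΩ₁
    ⟨_, ⟨δ, ⟨by linarith, le_refl _⟩, rfl⟩, h4 h2⟩ y hy
  have hst := hδ.inj (hsL hs) (hsR ht) (hsy.trans hty.symm)
  have hs0 : s = 0 := le_antisymm hs.2 (hst ▸ ht.1)
  rw [hs0, hδ.apply_zero] at hsy
  subst hsy
  -- then the chain is constant from `Ω₁` on
  have hsub : ⋃₀ c ⊆ Ω₁ := by
    by_contra hsub
    obtain ⟨x, hx, hx'⟩ := hconn.inter_frontier_nonempty'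
      (Ω := Ω₁) ⟨y₀, hmem, hy.mem⟩ hsub
    rw [hy.frontier_eq, mem_singleton_iff] at hx'
    rw [hopen.frontier_eq] at hz
    exact hz.2 (hx' ▸ hx)
  exact hy.notMem (interior_mono (closure_mono hsub) hnhds)

/-- A compact space that is locally an open arc, except at one point where it is locally a
half-open arc, does not exist. -/
theorem not_isHalfArcAt_of_isArcAt {Y : Type*} [TopologicalSpace Y] [T2Space Y] [CompactSpace Y]
    {y₀ : Y} (harc : ∀ y ≠ y₀, ∃ θ ε, IsArcAt θ ε y) {θ₀ : ℝ → Y} {ε₀ : ℝ} :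
    ¬ IsHalfArcAt θ₀ ε₀ y₀ := by
  intro hhalf
  obtain ⟨y, Ω, hΩ⟩ := hhalf.exists_isOpenSegment
  obtain ⟨M, -, hM⟩ := zorn_subset_nonempty {Ω : Set Y | ∃ y, IsOpenSegment y₀ y Ω}
    (fun c hc hchain hne => ⟨⋃₀ c, IsOpenSegment.sUnion_of_isChain harc hc hchain hne,
      fun s hs => subset_sUnion_of_mem hs⟩) Ω ⟨y, hΩ⟩
  obtain ⟨z, hz⟩ := hM.prop
  -- The end of a maximal segment is not `y₀`, so there is a two-sided arc around it along which the
  -- segment can be prolonged.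
  have hz₀ : z ≠ y₀ := fun h => hz.end_notMem (h ▸ hz.mem)
  obtain ⟨θ, ε, hθ⟩ := harc z hz₀
  obtain ⟨z', Ω', hΩ', hss⟩ := hz.exists_ssuperset hθ
  exact hss.2 (hM.le_of_ge ⟨z', hΩ'⟩ hss.1)

/-! ### Arcs from locally injective real functions -/

/-- The inverse is continuous because `f` maps the compact sets `C ∩ F`, with `F` closed, to closed
sets. -/
theorem exists_continuousOn_rightInverse {Y : Type*} [TopologicalSpace Y] [Nonempty Y]
    {f : Y → ℝ} {C : Set Y} (hC : IsCompact C) (hf : ContinuousOn f C) {S : Set ℝ}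
    (hinj : InjOn f C) (hS : S ⊆ f '' C) :
    ∃ g : ℝ → Y, ContinuousOn g S ∧ ∀ t ∈ S, g t ∈ C ∧ f (g t) = t := by
  have hg : ∀ t ∈ S, Function.invFunOn f C t ∈ C ∧ f (Function.invFunOn f C t) = t := fun t ht =>
    ⟨Function.invFunOn_mem (hS ht), Function.invFunOn_eq (hS ht)⟩
  refine ⟨Function.invFunOn f C, continuousOn_iff_isClosed.2 fun F hF => ?_, hg⟩
  refine ⟨f '' (C ∩ F), ((hC.inter_right hF).image_of_continuousOn
    (hf.mono inter_subset_left)).isClosed, ?_⟩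
  ext t
  constructor
  · rintro ⟨htF, htS⟩
    exact ⟨⟨_, ⟨(hg t htS).1, htF⟩, (hg t htS).2⟩, htS⟩
  · rintro ⟨⟨x, ⟨hxC, hxF⟩, rfl⟩, htS⟩
    refine ⟨?_, htS⟩
    rw [mem_preimage, hinj (hg _ htS).1 hxC (hg _ htS).2]
    exact hxF

/-- Local inverses of a locally injective continuous function on a compact space. -/
theorem exists_arc_of_injOn {Y : Type*} [TopologicalSpace Y] [T2Space Y] [CompactSpace Y] {y : Y}
    {f : Y → ℝ} (hf : Continuous f) {N : Set Y} (hN : N ∈ 𝓝 y) (hinj : InjOn f N) :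
    ∃ C ∈ 𝓝 y, IsOpen C ∧ ∀ S : Set ℝ, 0 ∈ S → (∀ t ∈ S, f y + t ∈ f '' C) →
      ∃ θ : ℝ → Y, ContinuousOn θ S ∧ InjOn θ S ∧ θ 0 = y ∧
        ∀ T ⊆ S, θ '' T = C ∩ f ⁻¹' ((fun t => f y + t) '' T) := by
  have : Nonempty Y := ⟨y⟩
  obtain ⟨K, hK, hKN, hKc⟩ := local_compact_nhds hN
  refine ⟨interior K, interior_mem_nhds.2 hK, isOpen_interior, fun S h0 hS => ?_⟩
  have hinjK : InjOn f K := hinj.mono hKN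
  obtain ⟨g, hg, hgS⟩ := exists_continuousOn_rightInverse hKc hf.continuousOn
    (S := (fun t => f y + t) '' S) hinjK (by
      rintro _ ⟨t, ht, rfl⟩
      exact image_mono interior_subset (hS t ht))
  have hgK : ∀ t ∈ S, g (f y + t) ∈ K ∧ f (g (f y + t)) = f y + t := fun t ht =>
    hgS _ ⟨t, ht, rfl⟩
  have huniq : ∀ t ∈ S, ∀ z ∈ K, f z = f y + t → g (f y + t) = z := fun t ht z hz hzt =>
    hinjK (hgK t ht).1 hz ((hgK t ht).2.trans hzt.symm)
  refine ⟨fun t => g (f y + t), hg.comp (by fun_prop) fun t ht => ⟨t, ht, rfl⟩, ?_, ?_, ?_⟩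
  · intro s hs t ht hst
    have h1 := congrArg f hst
    simp only [(hgK s hs).2, (hgK t ht).2] at h1
    linarith
  · exact huniq 0 h0 y (mem_of_mem_nhds hK) (by simp)
  · intro T hT
    ext z
    constructor
    · rintro ⟨t, ht, rfl⟩
      obtain ⟨x, hx, hxt⟩ := hS t (hT ht)
      refine ⟨?_, t, ht, (hgK t (hT ht)).2.symm⟩
      change g (f y + t) ∈ _
      rw [huniq t (hT ht) x (interior_subset hx) hxt]
      exact hx
    · rintro ⟨hz, t, ht, hzt⟩
      exact ⟨t, ht, huniq t (hT ht) z (interior_subset hz) hzt.symm⟩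

/-- A locally injective continuous function that is locally open at `y` yields an arc. -/
theorem exists_isArcAt {Y : Type*} [TopologicalSpace Y] [T2Space Y] [CompactSpace Y] {y : Y}
    {f : Y → ℝ} (hf : Continuous f) {N : Set Y} (hN : N ∈ 𝓝 y) (hinj : InjOn f N)
    (hmap : 𝓝 (f y) ≤ map f (𝓝 y)) : ∃ θ ε, IsArcAt θ ε y := by
  obtain ⟨C, hC, hCo, h⟩ := exists_arc_of_injOn hf hN hinj
  obtain ⟨ε, hε, hsub⟩ := Metric.nhds_basis_closedBall.mem_iff.1 (hmap (image_mem_map hC))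
  rw [Real.closedBall_eq_Icc] at hsub
  obtain ⟨θ, hcont, hinj, h0, him⟩ := h (Icc (-ε) ε) ⟨by linarith, by linarith⟩ fun t ht =>
    hsub ⟨by linarith [ht.1], by linarith [ht.2]⟩
  refine ⟨θ, ε, hε, hcont, hinj, h0, ?_⟩
  rw [him _ Ioo_subset_Icc_self, image_const_add_Ioo]
  exact hCo.inter (isOpen_Ioo.preimage hf)

/-- One-sided version of `exists_isArcAt`. -/
theorem exists_isHalfArcAt {Y : Type*} [TopologicalSpace Y] [T2Space Y] [CompactSpace Y] {y : Y}
    {f : Y → ℝ} (hf : Continuous f) (hle : ∀ z, f z ≤ f y) {N : Set Y} (hN : N ∈ 𝓝 y)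
    (hinj : InjOn f N) (hmap : 𝓝[≤] (f y) ≤ map f (𝓝 y)) : ∃ θ ε, IsHalfArcAt θ ε y := by
  obtain ⟨C, hC, hCo, h⟩ := exists_arc_of_injOn hf hN hinj
  obtain ⟨ε, hε, hsub⟩ := (Metric.nhds_basis_closedBall.inf_principal _).mem_iff.1
    (hmap (image_mem_map hC))
  rw [Real.closedBall_eq_Icc] at hsub
  obtain ⟨θ, hcont, hinj, h0, him⟩ := h (Icc (-ε) 0) ⟨by linarith, by linarith⟩ fun t ht =>
    hsub ⟨⟨by linarith [ht.1], by linarith [ht.2]⟩, show f y + t ≤ f y by linarith [ht.2]⟩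
  refine ⟨θ, ε, hε, hcont, hinj, h0, ?_⟩
  -- Since `f` never exceeds `f y`, the closed upper end of the interval imposes no condition and
  -- the preimage is open.
  have h1 : f ⁻¹' ((fun t => f y + t) '' Ioc (-ε) 0) = f ⁻¹' Ioi (f y - ε) := by
    ext z
    rw [image_const_add_Ioc]
    simp [hle, sub_eq_add_neg]
  rw [him _ Ioc_subset_Icc_self, h1]
  exact hCo.inter (isOpen_Ioi.preimage hf)

/-! ### The constant rank theorem -/

section ConstantRank

variable {X A B : Type*} [NormedAddCommGroup X] [NormedSpace ℝ X]
  [NormedAddCommGroup A] [NormedSpace ℝ A] [FiniteDimensional ℝ A]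
  [NormedAddCommGroup B] [NormedSpace ℝ B]

/-- If the derivative of `κ` vanishes on the kernel of that of a submersion `g`, then `κ` is locally
a function of `g`. -/
theorem exists_nhds_eq_of_ker_le_of_range_eq_top [FiniteDimensional ℝ X]
    {g : X → A} {κ : X → B} {g' : X → X →L[ℝ] A}
    {κ' : X → X →L[ℝ] B} {x₀ : X} (hgc : ContDiff ℝ 1 g) (hg : ∀ x, HasFDerivAt g (g' x) x)
    (hκ : ∀ x, HasFDerivAt κ (κ' x) x) (hsurj : (g' x₀).range = ⊤)
    (hker : ∀ᶠ x in 𝓝 x₀, (g' x).ker ≤ (κ' x).ker) :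
    ∃ N ∈ 𝓝 x₀, ∀ x ∈ N, ∀ x' ∈ N, g x = g x' → κ x = κ x' := by
  have := FiniteDimensional.complete ℝ X
  have := FiniteDimensional.complete ℝ A
  obtain ⟨P, hP⟩ := LinearMap.exists_leftInverse_of_injective (g' x₀).ker.subtype
    (Submodule.ker_subtype _)
  have hP' : ∀ w (hw : w ∈ (g' x₀).ker), P w = ⟨w, hw⟩ := fun w hw =>
    LinearMap.congr_fun hP ⟨w, hw⟩
  let Pc : X →L[ℝ] (g' x₀).ker := LinearMap.toContinuousLinearMap P
  -- A projection onto the kernel at `x₀` completes `g` to a local diffeomorphism `Φ`, in whose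
  -- coordinates the fibres of `g` are slices.
  let e : X ≃L[ℝ] A × (g' x₀).ker := ContinuousLinearEquiv.ofBijective ((g' x₀).prod Pc)
    (by
      refine LinearMap.ker_eq_bot'.2 fun w hw => ?_
      have h1 : g' x₀ w = 0 := congrArg Prod.fst hw
      have h2 : P w = 0 := congrArg Prod.snd hw
      rw [hP' w h1] at h2
      exact congrArg Subtype.val h2)
    (by
      refine LinearMap.range_eq_top.2 fun ⟨a, u⟩ => ?_
      obtain ⟨w, hw⟩ := LinearMap.range_eq_top.1 hsurj a
      have hw' : g' x₀ w = a := hw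
      refine ⟨w + (u - P w : (g' x₀).ker), Prod.ext ?_ ?_⟩
      · change g' x₀ (w + (u - P w : (g' x₀).ker)) = a
        have h1 : g' x₀ (u - P w : (g' x₀).ker) = 0 := (u - P w).2
        rw [map_add, hw', h1, add_zero]
      · change P (w + (u - P w : (g' x₀).ker)) = u
        rw [map_add, hP' _ (u - P w).2, Subtype.coe_eta, add_sub_cancel])
  let Φ : X → A × (g' x₀).ker := fun x => (g x, Pc x)
  have hΦc : ContDiffAt ℝ 1 Φ x₀ := (hgc.prodMk Pc.contDiff).contDiffAt
  have hΦ : HasFDerivAt Φ (e : X →L[ℝ] A × (g' x₀).ker) x₀ := (hg x₀).prodMk Pc.hasFDerivAt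
  set ψ := hΦc.localInverse hΦ one_ne_zero with hψ
  have hψ0 : ψ (Φ x₀) = x₀ := hΦc.localInverse_apply_image hΦ one_ne_zero
  have hψc : ContDiffAt ℝ 1 ψ (Φ x₀) := hΦc.to_localInverse hΦ one_ne_zero
  have hst : HasStrictFDerivAt Φ (e : X →L[ℝ] A × (g' x₀).ker) x₀ :=
    hΦc.hasStrictFDerivAt' hΦ one_ne_zero
  have hright : ∀ᶠ z in 𝓝 (Φ x₀), Φ (ψ z) = z := hst.eventually_right_inverse
  have hleft : ∀ᶠ x in 𝓝 x₀, ψ (Φ x) = x := hst.eventually_left_inverse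
  have hkerψ : ∀ᶠ z in 𝓝 (Φ x₀), (g' (ψ z)).ker ≤ (κ' (ψ z)).ker := by
    have h1 : Tendsto ψ (𝓝 (Φ x₀)) (𝓝 x₀) := by
      have := hψc.continuousAt.tendsto
      rwa [hψ0] at this
    exact h1.eventually hker
  obtain ⟨δ, hδ, hball⟩ := Metric.eventually_nhds_iff_ball.1
    (hright.and (hkerψ.and (hψc.eventually (by simp))))
  refine ⟨{x | ψ (Φ x) = x ∧ Φ x ∈ Metric.ball (Φ x₀) δ}, inter_mem hleft
    (hΦ.continuousAt (Metric.ball_mem_nhds _ hδ)), ?_⟩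
  rintro x ⟨hx, hxb⟩ x' ⟨hx', hxb'⟩ hgx
  have hmem : ∀ u, (g x, u) ∈ Metric.ball (Φ x₀) δ ↔
      g x ∈ Metric.ball (g x₀) δ ∧ u ∈ Metric.ball (Pc x₀) δ := by
    intro u
    rw [← ball_prod_same]
    rfl
  have hgball := ((hmem _).1 hxb).1
  -- Along a slice `g` is constant, so the velocity lies in the kernel of `g'` and therefore in that
  -- of `κ'`. Slices of a product ball are balls, hence connected, so `κ` is constant on them.
  have hderiv : ∀ u ∈ Metric.ball (Pc x₀) δ, HasFDerivAt (fun u => κ (ψ (g x, u)))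
      (0 : (g' x₀).ker →L[ℝ] B) u := by
    intro u hu
    have hz := (hmem u).2 ⟨hgball, hu⟩
    obtain ⟨-, h2, h3⟩ := hball _ hz
    have hd : HasFDerivAt ψ (fderiv ℝ ψ (g x, u)) (g x, u) :=
      (h3.differentiableAt one_ne_zero).hasFDerivAt
    have hin : HasFDerivAt (fun u : (g' x₀).ker => (g x, u))
      (ContinuousLinearMap.inr ℝ A (g' x₀).ker) u := hasFDerivAt_prodMk_right (g x) u
    have h4 := (hκ (ψ (g x, u))).comp u (hd.comp u hin)
    have h5 := (hg (ψ (g x, u))).comp u (hd.comp u hin)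
    have h6 : HasFDerivAt (fun u => g (ψ (g x, u))) (0 : (g' x₀).ker →L[ℝ] A) u := by
      refine (hasFDerivAt_const (g x) u).congr_of_eventuallyEq ?_
      filter_upwards [Metric.isOpen_ball.mem_nhds hu] with u' hu'
      exact congrArg Prod.fst (hball _ ((hmem u').2 ⟨hgball, hu'⟩)).1
    have h7 := h5.unique h6
    convert! h4 using 1
    ext v
    exact (h2 (DFunLike.congr_fun h7 v)).symm
  have hconst := Metric.isOpen_ball.is_const_of_fderiv_eq_zero (𝕜 := ℝ)
    (convex_ball (Pc x₀) δ).isPreconnected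
    (fun u hu => (hderiv u hu).differentiableAt.differentiableWithinAt)
    (fun u hu => (hderiv u hu).fderiv)
    ((hmem (Pc x)).1 hxb).2
    (((hmem (Pc x')).1 (by rw [hgx]; exact hxb')).2)
  calc κ x = κ (ψ (g x, Pc x)) := by rw [show ψ (g x, Pc x) = x from hx]
    _ = κ (ψ (g x, Pc x')) := hconst
    _ = κ x' := by rw [hgx, show ψ (g x', Pc x') = x' from hx']

/-- Surjectivity is an open condition. -/
theorem eventually_range_eq_top {g' : X → X →L[ℝ] A} {x₀ : X} (hg : ContinuousAt g' x₀)
    (hsurj : (g' x₀).range = ⊤) : ∀ᶠ x in 𝓝 x₀, (g' x).range = ⊤ := by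
  have := FiniteDimensional.complete ℝ A
  obtain ⟨R, hR⟩ := LinearMap.exists_rightInverse_of_surjective (g' x₀ : X →ₗ[ℝ] A) hsurj
  let Rc : A →L[ℝ] X := LinearMap.toContinuousLinearMap R
  have h1 : ContinuousAt (fun x => (g' x).comp Rc) x₀ := hg.clm_comp continuousAt_const
  have h2 : (g' x₀).comp Rc = 1 := by
    ext a
    exact LinearMap.congr_fun hR a
  have h3 : ∀ᶠ x in 𝓝 x₀, IsUnit ((g' x).comp Rc) := by
    refine h1.eventually (Units.isOpen.mem_nhds ?_)
    change IsUnit ((g' x₀).comp Rc)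
    rw [h2]
    exact isUnit_one
  filter_upwards [h3] with x hx
  obtain ⟨S, hS⟩ := hx.exists_right_inv
  refine LinearMap.range_eq_top.2 fun a => ⟨Rc (S a), ?_⟩
  exact DFunLike.congr_fun hS a

/-- Constant rank theorem: if `g` and `κ` have the same infinitesimal kernel at `x₀`, and that of `κ`
does not shrink near `x₀`, then `κ` is locally a function of `g`. -/
theorem exists_nhds_eq_of_ker_le [FiniteDimensional ℝ X] {g : X → A} {κ : X → B} {g' : X → X →L[ℝ] A}
    {κ' : X → X →L[ℝ] B} {x₀ : X} (hgc : ContDiff ℝ 1 g) (hg : ∀ x, HasFDerivAt g (g' x) x)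
    (hκ : ∀ x, HasFDerivAt κ (κ' x) x) (h₀ : (g' x₀).ker ≤ (κ' x₀).ker)
    (hker : ∀ᶠ x in 𝓝 x₀, (κ' x).ker ≤ (g' x).ker)
    (hrank : ∀ᶠ x in 𝓝 x₀, Module.finrank ℝ (κ' x₀).ker ≤ Module.finrank ℝ (κ' x).ker) :
    ∃ N ∈ 𝓝 x₀, ∀ x ∈ N, ∀ x' ∈ N, g x = g x' → κ x = κ x' := by
  obtain ⟨P, hP⟩ := LinearMap.exists_leftInverse_of_injective (g' x₀).range.subtype
    (Submodule.ker_subtype _)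
  -- Projecting onto the range of `g' x₀` makes `g` a submersion at `x₀` without changing its kernel
  -- there.
  let Pc : A →L[ℝ] (g' x₀).range := LinearMap.toContinuousLinearMap P
  have hP' : ∀ w, Pc (g' x₀ w) = ⟨g' x₀ w, w, rfl⟩ := fun w =>
    LinearMap.congr_fun hP ⟨g' x₀ w, w, rfl⟩
  have hsurj : (Pc.comp (g' x₀)).range = ⊤ := by
    refine LinearMap.range_eq_top.2 ?_
    rintro ⟨_, w, rfl⟩
    exact ⟨w, hP' w⟩
  have hker₀ : (Pc.comp (g' x₀)).ker = (g' x₀).ker := by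
    ext w
    constructor
    · intro hw
      have h1 : Pc (g' x₀ w) = 0 := hw
      rw [hP'] at h1
      exact congrArg Subtype.val h1
    · intro hw
      have h1 : g' x₀ w = 0 := hw
      change Pc (g' x₀ w) = 0
      rw [h1, map_zero]
  have hcont : Continuous g' := by
    have : g' = fderiv ℝ g := funext fun x => (hg x).fderiv.symm
    rw [this]
    exact hgc.continuous_fderiv one_ne_zero
  have hdim : ∀ x, (Pc.comp (g' x)).range = ⊤ →
      Module.finrank ℝ (Pc.comp (g' x)).ker = Module.finrank ℝ (Pc.comp (g' x₀)).ker := by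
    intro x hx
    have h1 := LinearMap.finrank_range_add_finrank_ker (Pc.comp (g' x)).toLinearMap
    have h2 := LinearMap.finrank_range_add_finrank_ker (Pc.comp (g' x₀)).toLinearMap
    rw [hx] at h1
    rw [hsurj] at h2
    omega
  refine (exists_nhds_eq_of_ker_le_of_range_eq_top (g := fun x => Pc (g x))
    (g' := fun x => Pc.comp (g' x)) (Pc.contDiff.comp hgc) (fun x => Pc.hasFDerivAt.comp x (hg x))
    hκ hsurj ?_).imp fun N hN => ⟨hN.1, fun x hx x' hx' h => hN.2 x hx x' hx' (by rw [h])⟩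
  -- Near `x₀` the projected kernel contains that of `κ'` and has constant dimension, at most that
  -- of `(κ' x₀).ker`; the rank bound forces equality.
  filter_upwards [hker, hrank, eventually_range_eq_top
    (g' := fun x => Pc.comp (g' x)) (continuousAt_const.clm_comp hcont.continuousAt) hsurj]
    with x h1 h2 h3
  have h4 : (κ' x).ker ≤ (Pc.comp (g' x)).ker := fun w hw => by
    have : g' x w = 0 := h1 hw
    change Pc (g' x w) = 0
    rw [this, map_zero]
  refine (Submodule.eq_of_le_of_finrank_le h4 ?_).ge
  rw [hdim x h3, hker₀]
  exact (Submodule.finrank_mono h₀).trans h2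

/-- If `f` has maximal rank at `x₀`, a function with nonvanishing derivative on the kernel of that
of `f` is locally open on the fibre of `f` through `x₀`. -/
theorem image_fiber_mem_nhds [FiniteDimensional ℝ X]
    {f : X → A} {f' : X → X →L[ℝ] A} {l : X → ℝ} {l' : X →L[ℝ] ℝ} {x₀ : X}
    (hfc : ContDiff ℝ 1 f) (hf : ∀ x, HasFDerivAt f (f' x) x) (hl : HasStrictFDerivAt l l' x₀)
    (hrank : ∀ᶠ x in 𝓝 x₀, Module.finrank ℝ (f' x₀).ker ≤ Module.finrank ℝ (f' x).ker)
    (hne : ∃ w ∈ (f' x₀).ker, l' w ≠ 0) {N : Set X} (hN : N ∈ 𝓝 x₀) :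
    l '' {x | x ∈ N ∧ f x = f x₀} ∈ 𝓝 (l x₀) := by
  have := FiniteDimensional.complete ℝ X
  obtain ⟨P, hP⟩ := LinearMap.exists_leftInverse_of_injective (f' x₀).range.subtype
    (Submodule.ker_subtype _)
  let Pc : A →L[ℝ] (f' x₀).range := LinearMap.toContinuousLinearMap P
  have hP' : ∀ w, Pc (f' x₀ w) = ⟨f' x₀ w, w, rfl⟩ := fun w =>
    LinearMap.congr_fun hP ⟨f' x₀ w, w, rfl⟩
  obtain ⟨w₀, hw₀, hlw₀⟩ := hne
  have hw₀' : f' x₀ w₀ = 0 := hw₀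
  -- By constant rank, `f` is locally determined by its projection `Pc ∘ f`, so solving for the
  -- submersion `(Pc ∘ f, l)` keeps `f` itself fixed.
  obtain ⟨M, hM, hMeq⟩ := exists_nhds_eq_of_ker_le (g := fun x => Pc (f x)) (κ := f)
    (g' := fun x => Pc.comp (f' x)) (Pc.contDiff.comp hfc) (fun x => Pc.hasFDerivAt.comp x (hf x))
    hf (x₀ := x₀) (fun w hw => by
      have h1 : Pc (f' x₀ w) = 0 := hw
      rw [hP'] at h1
      exact congrArg Subtype.val h1)
    (Eventually.of_forall fun x w hw => by
      have h1 : f' x w = 0 := hw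
      change Pc (f' x w) = 0
      rw [h1, map_zero]) hrank
  have hst : HasStrictFDerivAt (fun x => (Pc (f x), l x)) ((Pc.comp (f' x₀)).prod l') x₀ :=
    (Pc.hasStrictFDerivAt.comp x₀ (hfc.contDiffAt.hasStrictFDerivAt' (hf x₀) one_ne_zero)).prodMk hl
  have hsurj : ((Pc.comp (f' x₀)).prod l').range = ⊤ := by
    refine LinearMap.range_eq_top.2 ?_
    rintro ⟨⟨_, w, rfl⟩, t⟩
    refine ⟨w + ((t - l' w) / l' w₀) • w₀, Prod.ext ?_ ?_⟩
    · change Pc (f' x₀ (w + ((t - l' w) / l' w₀) • w₀)) = _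
      rw [map_add, map_smul, hw₀', smul_zero, add_zero]
      exact hP' w
    · change l' (w + ((t - l' w) / l' w₀) • w₀) = t
      rw [map_add, map_smul, smul_eq_mul, div_mul_cancel₀ _ hlw₀]
      ring
  have hmap := hst.map_nhds_eq_of_surj hsurj
  have h1 := image_mem_map (m := fun x => (Pc (f x), l x)) (inter_mem hN hM)
  rw [hmap] at h1
  have h2 : ∀ᶠ t in 𝓝 (l x₀), (Pc (f x₀), t) ∈
      (fun x => (Pc (f x), l x)) '' (N ∩ M) :=
    (Continuous.prodMk_right (Pc (f x₀))).continuousAt.eventually h1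
  filter_upwards [h2] with t ht
  obtain ⟨x, ⟨hxN, hxM⟩, hx⟩ := ht
  exact ⟨x, ⟨hxN, hMeq x hxM x₀ (mem_of_mem_nhds hM) (congrArg Prod.fst hx)⟩, congrArg Prod.snd hx⟩

end ConstantRank

/-! ### Invariants of configurations under isometries fixing `U` -/

section CongruenceMap

variable {V H : Type*} [NormedAddCommGroup H] [InnerProductSpace ℝ H] [FiniteDimensional ℝ H]

/-- Two families of vectors with the same Gram matrix differ by a linear isometry. -/
theorem exists_linearIsometry_apply_eq {ι : Type*} {x y : ι → H}
    (h : ∀ i j, ⟪x i, x j⟫ = ⟪y i, y j⟫) : ∃ R : H →ₗᵢ[ℝ] H, ∀ i, R (x i) = y i := by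
  let T : (ι →₀ ℝ) →ₗ[ℝ] H := Finsupp.linearCombination ℝ x
  let Y : (ι →₀ ℝ) →ₗ[ℝ] H := Finsupp.linearCombination ℝ y
  have hnorm : ∀ c, ‖Y c‖ = ‖T c‖ := by
    intro c
    have : ⟪Y c, Y c⟫ = ⟪T c, T c⟫ := by
      simp only [T, Y, Finsupp.linearCombination_apply, Finsupp.sum, sum_inner, inner_sum,
        real_inner_smul_left, real_inner_smul_right, h]
    rw [real_inner_self_eq_norm_sq, real_inner_self_eq_norm_sq] at this
    exact (sq_eq_sq₀ (norm_nonneg _) (norm_nonneg _)).1 this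
  obtain ⟨R, hR⟩ := LinearMap.exists_rightInverse_of_surjective T.rangeRestrict
    T.range_rangeRestrict
  have hR' : ∀ z, T (R z) = z := fun z => congrArg Subtype.val (LinearMap.congr_fun hR z)
  let f : T.range →ₗᵢ[ℝ] H := ⟨Y ∘ₗ R, fun z => by
    change ‖Y (R z)‖ = ‖z‖
    rw [hnorm, hR']
    rfl⟩
  refine ⟨f.extend, fun i => ?_⟩
  have hxi : T (Finsupp.single i 1) = x i := by simp [T]
  have hyi : Y (Finsupp.single i 1) = y i := by simp [Y]
  have hmem : x i ∈ T.range := ⟨_, hxi⟩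
  have h1 : f.extend (x i) = f ⟨x i, hmem⟩ := f.extend_apply ⟨x i, hmem⟩
  rw [h1, ← hyi]
  change Y (R ⟨x i, hmem⟩) = _
  rw [← sub_eq_zero, ← map_sub, ← norm_eq_zero, hnorm, map_sub, hR', hxi]
  simp

/-- The complete system of invariants of a configuration `q` under the isometries whose linear part
fixes `U`. -/
noncomputable def congruenceMap (U : Submodule ℝ H) (q : V → H) : V × V → ℝ × H :=
  fun uv => (‖q uv.1 - q uv.2‖ ^ 2, U.starProjection (q uv.1 - q uv.2))

/-- The derivative of `congruenceMap`. -/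
noncomputable def congruenceMapDeriv (U : Submodule ℝ H) (q : V → H) :
    (V → H) →L[ℝ] (V × V → ℝ × H) :=
  ContinuousLinearMap.pi fun uv =>
    ((2 : ℕ) • (innerSL ℝ (q uv.1 - q uv.2)).comp
      (ContinuousLinearMap.proj (R := ℝ) (φ := fun _ : V => H) uv.1 -
        ContinuousLinearMap.proj (R := ℝ) (φ := fun _ : V => H) uv.2)).prod
    (U.starProjection.comp (ContinuousLinearMap.proj (R := ℝ) (φ := fun _ : V => H) uv.1 -
        ContinuousLinearMap.proj (R := ℝ) (φ := fun _ : V => H) uv.2))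

theorem congruenceMapDeriv_apply (U : Submodule ℝ H) (q w : V → H) (uv : V × V) :
    congruenceMapDeriv U q w uv =
      (2 * ⟪q uv.1 - q uv.2, w uv.1 - w uv.2⟫, U.starProjection (w uv.1 - w uv.2)) := by
  refine Prod.ext ?_ rfl
  simp [congruenceMapDeriv, inner_sub_left, inner_sub_right]

theorem ker_congruenceMapDeriv (U : Submodule ℝ H) (q : V → H) :
    (congruenceMapDeriv U q).ker = infinitesimalCongruences U q := by
  ext w
  have h1 : w ∈ (congruenceMapDeriv U q).ker ↔ ∀ uv, congruenceMapDeriv U q w uv = 0 :=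
    funext_iff
  rw [h1, Prod.forall]
  refine forall_congr' fun u => forall_congr' fun v => ?_
  rw [congruenceMapDeriv_apply, Prod.ext_iff]
  simp only [Prod.fst_zero, Prod.snd_zero, mul_eq_zero, OfNat.ofNat_ne_zero, false_or]
  rw [Submodule.starProjection_apply_eq_zero_iff]

theorem contDiff_congruenceMap [Fintype V] (U : Submodule ℝ H) :
    ContDiff ℝ 1 (congruenceMap U : (V → H) → V × V → ℝ × H) := by
  refine contDiff_pi' fun uv => ContDiff.prodMk (ContDiff.norm_sq ℝ ?_) ?_
  · fun_prop
  · fun_prop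

theorem hasFDerivAt_congruenceMap [Fintype V] (U : Submodule ℝ H) (q : V → H) :
    HasFDerivAt (congruenceMap U) (congruenceMapDeriv U q) q := by
  refine hasFDerivAt_pi.2 fun uv => ?_
  have h : HasFDerivAt (fun q : V → H => q uv.1 - q uv.2)
      (ContinuousLinearMap.proj (R := ℝ) (φ := fun _ : V => H) uv.1 -
        ContinuousLinearMap.proj (R := ℝ) (φ := fun _ : V => H) uv.2) q :=
    ((ContinuousLinearMap.proj (R := ℝ) (φ := fun _ : V => H) uv.1).hasFDerivAt).sub
      ((ContinuousLinearMap.proj (R := ℝ) (φ := fun _ : V => H) uv.2).hasFDerivAt)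
  exact h.norm_sq.prodMk (U.starProjection.hasFDerivAt.comp q h)

theorem congruenceMap_isometry (U : Submodule ℝ H) (q : V → H) (R : H →ₗᵢ[ℝ] H)
    (hR : ∀ z ∈ U, R z = z) (t : H) :
    congruenceMap U (fun v => R (q v) + t) = congruenceMap U q := by
  funext uv
  have h1 : R (q uv.1) + t - (R (q uv.2) + t) = R (q uv.1 - q uv.2) := by
    rw [map_sub]
    abel
  refine Prod.ext ?_ ?_
  · change ‖R (q uv.1) + t - (R (q uv.2) + t)‖ ^ 2 = ‖q uv.1 - q uv.2‖ ^ 2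
    rw [h1, R.norm_map]
  · change U.starProjection (R (q uv.1) + t - (R (q uv.2) + t)) = U.starProjection (q uv.1 - q uv.2)
    rw [h1, ← sub_eq_zero, ← map_sub, Submodule.starProjection_apply_eq_zero_iff,
      Submodule.mem_orthogonal]
    intro z hz
    have h2 : ⟪z, R (q uv.1 - q uv.2)⟫ = ⟪z, q uv.1 - q uv.2⟫ := by
      conv_lhs => rw [← hR z hz]
      exact R.inner_map_map _ _
    rw [inner_sub_right, h2, sub_self]

/-- Polarization turns distances into inner products of differences. Adjoining all vectors of `U` to
the family makes the resulting isometry fix `U`, and the projections onto `U` supply the mixed inner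
products. -/
theorem exists_isometry_of_congruenceMap_eq [Nonempty V] (U : Submodule ℝ H) {q q' : V → H}
    (h : congruenceMap U q = congruenceMap U q') :
    ∃ (R : H →ₗᵢ[ℝ] H) (t : H), (∀ z ∈ U, R z = z) ∧ ∀ v, R (q v) + t = q' v := by
  obtain ⟨v₀⟩ := ‹Nonempty V›
  have hd : ∀ u v, ‖q u - q v‖ ^ 2 = ‖q' u - q' v‖ ^ 2 := fun u v =>
    congrArg Prod.fst (congrFun h (u, v))
  have hU : ∀ z ∈ U, ∀ u v, ⟪z, q u - q v⟫ = ⟪z, q' u - q' v⟫ := by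
    intro z hz u v
    have h1 : U.starProjection (q u - q v) = U.starProjection (q' u - q' v) :=
      congrArg Prod.snd (congrFun h (u, v))
    rw [← sub_eq_zero, ← map_sub, Submodule.starProjection_apply_eq_zero_iff,
      Submodule.mem_orthogonal] at h1
    have := h1 z hz
    rw [inner_sub_right] at this
    linarith
  have hpol : ∀ (r : V → H) u v, ⟪r u - r v₀, r v - r v₀⟫ =
      (‖r u - r v₀‖ ^ 2 + ‖r v - r v₀‖ ^ 2 - ‖r u - r v‖ ^ 2) / 2 := by
    intro r u v
    have := norm_sub_sq_real (r u - r v₀) (r v - r v₀)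
    rw [sub_sub_sub_cancel_right] at this
    linarith
  obtain ⟨R, hR⟩ := exists_linearIsometry_apply_eq
    (x := (Sum.elim (fun v => q v - q v₀) (fun z : U => (z : H)) : V ⊕ U → H))
    (y := Sum.elim (fun v => q' v - q' v₀) (fun z : U => (z : H))) (by
      rintro (u | z) (v | z')
      · change ⟪q u - q v₀, q v - q v₀⟫ = ⟪q' u - q' v₀, q' v - q' v₀⟫
        rw [hpol, hpol, hd, hd, hd]
      · change ⟪q u - q v₀, (z' : H)⟫ = ⟪q' u - q' v₀, (z' : H)⟫
        rw [real_inner_comm, hU _ z'.2, real_inner_comm]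
      · exact hU _ z.2 _ _
      · rfl)
  refine ⟨R, q' v₀ - R (q v₀), fun z hz => hR (Sum.inr ⟨z, hz⟩), fun v => ?_⟩
  have h1 : R (q v - q v₀) = q' v - q' v₀ := hR (Sum.inl v)
  rw [map_sub] at h1
  rw [← add_sub_assoc, add_sub_right_comm, h1, sub_add_cancel]

/-- `congruenceMap` is open onto its image. -/
theorem exists_nhds_congruenceMap [Fintype V] [Nonempty V] (U : Submodule ℝ H) {q₀ : V → H}
    {N : Set (V → H)} (hN : N ∈ 𝓝 q₀) : ∃ S ∈ 𝓝 (congruenceMap U q₀), ∀ q, congruenceMap U q ∈ S →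
      ∃ q' ∈ N, congruenceMap U q' = congruenceMap U q := by
  obtain ⟨v₀⟩ := ‹Nonempty V›
  have := FiniteDimensional.proper ℝ H
  have hcont : Continuous (congruenceMap U : (V → H) → V × V → ℝ × H) :=
    (contDiff_congruenceMap U).continuous
  set r : V → ℝ := fun v => ‖q₀ v - q₀ v₀‖ ^ 2 + 1 with hr
  let K : Set (V → H) := Set.pi univ fun v => Metric.closedBall (q₀ v₀) (r v + 1)
  -- The configurations in `K` that no admissible isometry moves into the interior of `N` form a
  -- compact set, so their invariants can be removed from a neighbourhood. The bounds in `S` ensure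
  -- that a translate lies in `K`.
  let Z : Set (V → H) := K ∩ ⋂ (R : H →ₗᵢ[ℝ] H) (t : H) (_ : ∀ z ∈ U, R z = z),
    (fun (q : V → H) v => R (q v) + t) ⁻¹' (interior N)ᶜ
  have hZ : IsCompact Z := by
    refine (isCompact_univ_pi fun v => isCompact_closedBall _ _).inter_right ?_
    refine isClosed_iInter fun R => isClosed_iInter fun t => isClosed_iInter fun _ => ?_
    refine isOpen_interior.isClosed_compl.preimage ?_
    exact continuous_pi fun v => (R.continuous.comp (continuous_apply v)).add continuous_const
  let S : Set (V × V → ℝ × H) := (congruenceMap U '' Z)ᶜ ∩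
    ⋂ v, {y | (y (v, v₀)).1 < r v}
  refine ⟨S, IsOpen.mem_nhds ?_ ⟨?_, ?_⟩, ?_⟩
  · refine (hZ.image hcont).isClosed.isOpen_compl.inter (isOpen_iInter_of_finite fun v => ?_)
    exact isOpen_lt (by fun_prop) continuous_const
  · rintro ⟨z, ⟨-, hz⟩, hzq⟩
    obtain ⟨R, t, hR, hRt⟩ := exists_isometry_of_congruenceMap_eq U hzq
    simp only [mem_iInter] at hz
    refine hz R t hR ?_
    rw [show (fun (q : V → H) v => R (q v) + t) z = q₀ from funext hRt]
    exact mem_interior_iff_mem_nhds.2 hN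
  · simp only [mem_iInter]
    intro v
    change ‖q₀ v - q₀ v₀‖ ^ 2 < ‖q₀ v - q₀ v₀‖ ^ 2 + 1
    linarith
  · rintro q ⟨hq1, hq2⟩
    simp only [mem_iInter] at hq2
    let q₁ : V → H := fun v => LinearIsometry.id (R := ℝ) (q v) + (q₀ v₀ - q v₀)
    have hq₁ : congruenceMap U q₁ = congruenceMap U q :=
      congruenceMap_isometry U q LinearIsometry.id (fun z _ => rfl) _
    have hK : q₁ ∈ K := by
      intro v _
      have h1 : ‖q v - q v₀‖ ^ 2 < r v := hq2 v
      have h2 : q₁ v - q₀ v₀ = q v - q v₀ := by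
        change q v + (q₀ v₀ - q v₀) - q₀ v₀ = _
        abel
      rw [mem_closedBall_iff_norm, h2]
      nlinarith [sq_nonneg (‖q v - q v₀‖ - 1), norm_nonneg (q v - q v₀)]
    have hnZ : q₁ ∉ Z := fun h => hq1 ⟨q₁, h, hq₁⟩
    have : ¬ q₁ ∈ ⋂ (R : H →ₗᵢ[ℝ] H) (t : H) (_ : ∀ z ∈ U, R z = z),
      (fun (q : V → H) v => R (q v) + t) ⁻¹' (interior N)ᶜ := fun h => hnZ ⟨hK, h⟩
    simp only [mem_iInter, not_forall, mem_preimage, mem_compl_iff, not_not] at this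
    obtain ⟨R, t, hR, hmem⟩ := this
    exact ⟨_, interior_subset hmem, (congruenceMap_isometry U q₁ R hR t).trans hq₁⟩

end CongruenceMap

/-! ### Nondegeneracy of generic configurations -/

/-- A generic configuration of at least `d + 1` points affinely spans `ℝ^d`. -/
theorem IsGenericRealization.spansModulo {V Γ : Type*} [Fintype V] [AddCommGroup Γ] {d : ℕ}
    {L : Γ →+ EuclideanSpace ℝ (Fin d)} {p : V → EuclideanSpace ℝ (Fin d)}
    (hp : IsGenericRealization L p) (hV : d + 1 ≤ Fintype.card V)
    (U : Submodule ℝ (EuclideanSpace ℝ (Fin d))) : SpansModulo U p := by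
  classical
  obtain ⟨φ⟩ : Nonempty (Fin (d + 1) ↪ V) :=
    Function.Embedding.nonempty_of_card_le (by simpa using hV)
  let A : Matrix V (Fin d) (MvPolynomial (V × Fin d) (coordField L)) := Matrix.of fun v i =>
    MvPolynomial.X (v, i) - MvPolynomial.X (φ 0, i)
  -- A test configuration: one vertex at the origin and `d` others at the standard basis vectors,
  -- for which the matrix of differences contains the identity.
  let x : V × Fin d → ℝ := fun vi => if vi.1 = φ vi.2.succ then 1 else 0
  have h1 : (A.map (MvPolynomial.aeval x)).submatrix (φ ∘ Fin.succ) id = 1 := by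
    ext i j
    have h2 : ¬ (0 : Fin (d + 1)) = j.succ := (Fin.succ_ne_zero j).symm
    simp [A, x, h2, Matrix.one_apply]
  have h2 := Matrix.rank_submatrix_le (A.map (MvPolynomial.aeval x)) (φ ∘ Fin.succ) id
  rw [h1, Matrix.rank_one, Fintype.card_fin] at h2
  have h3 := h2.trans (AlgebraicIndependent.rank_map_aeval_le hp A x)
  rw [Matrix.rank] at h3
  have h4 := LinearMap.finrank_range_add_finrank_ker (A.map (MvPolynomial.aeval
    fun vi : V × Fin d => p vi.1 vi.2)).mulVecLin
  rw [Module.finrank_fin_fun] at h4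
  have h5 : (A.map (MvPolynomial.aeval fun vi : V × Fin d => p vi.1 vi.2)).mulVecLin.ker = ⊥ :=
    Submodule.finrank_eq_zero.1 (by omega)
  intro a _ ha
  have h6 : WithLp.ofLp a ∈ (A.map (MvPolynomial.aeval
      fun vi : V × Fin d => p vi.1 vi.2)).mulVecLin.ker := by
    refine funext fun v => ?_
    have := ha v (φ 0)
    rw [PiLp.inner_apply] at this
    simp only [Matrix.mulVecLin_apply, Matrix.mulVec, dotProduct, Pi.zero_apply]
    rw [← this]
    refine Finset.sum_congr rfl fun i _ => ?_
    simp [A]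
  rw [h5, Submodule.mem_bot] at h6
  exact PiLp.ext fun i => congrFun h6 i

/-! ### Edge lengths in terms of the invariants; connectedness and boundedness -/

namespace LabeledGraph

variable {V E Γ : Type*} [AddCommGroup Γ] {d : ℕ}

/-- The squared length of an edge as a linear function of the invariants `congruenceMap`. -/
noncomputable def edgeFunctional (u v : V) (z : EuclideanSpace ℝ (Fin d)) :
    (V × V → ℝ × EuclideanSpace ℝ (Fin d)) →L[ℝ] ℝ :=
  (ContinuousLinearMap.fst ℝ _ _ - (2 : ℝ) • (innerSL ℝ z).comp (ContinuousLinearMap.snd ℝ _ _)).comp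
    (ContinuousLinearMap.proj (R := ℝ) (φ := fun _ : V × V => ℝ × EuclideanSpace ℝ (Fin d)) (u, v))

theorem edgeFunctional_apply (u v : V) (z : EuclideanSpace ℝ (Fin d))
    (y : V × V → ℝ × EuclideanSpace ℝ (Fin d)) :
    edgeFunctional u v z y = (y (u, v)).1 - 2 * ⟪z, (y (u, v)).2⟫ := rfl

theorem inner_starProjection_span_range (L : Γ →+ EuclideanSpace ℝ (Fin d)) (γ : Γ)
    (z : EuclideanSpace ℝ (Fin d)) :
    ⟪L γ, (Submodule.span ℝ (range L)).starProjection z⟫ = ⟪L γ, z⟫ := by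
  have h : L γ ∈ Submodule.span ℝ (range L) := Submodule.subset_span ⟨γ, rfl⟩
  rw [← Submodule.inner_starProjection_left_eq_right, Submodule.starProjection_eq_self_iff.2 h]

/-- In the expanded square the cross term with `L γ` only sees the projection onto the span. Because
the dependence is affine, the length of the deleted edge can serve as a linear coordinate on the
space of invariants. -/
theorem lengthSq_eq_edgeFunctional (G : LabeledGraph V E Γ) (L : Γ →+ EuclideanSpace ℝ (Fin d))
    (q : V → EuclideanSpace ℝ (Fin d)) (e : E) :
    G.lengthSq L q e = edgeFunctional (G.src e) (G.tgt e) (L (G.label e))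
      (congruenceMap (Submodule.span ℝ (range L)) q) + ‖L (G.label e)‖ ^ 2 := by
  rw [edgeFunctional_apply]
  simp only [congruenceMap, inner_starProjection_span_range, lengthSq]
  rw [← sub_sub, norm_sub_sq_real, real_inner_comm]

theorem rigidityMap_eq_edgeFunctional (G : LabeledGraph V E Γ) (L : Γ →+ EuclideanSpace ℝ (Fin d))
    (q w : V → EuclideanSpace ℝ (Fin d)) (e : E) :
    G.rigidityMap L q w e = edgeFunctional (G.src e) (G.tgt e) (L (G.label e))
      (congruenceMapDeriv (Submodule.span ℝ (range L)) q w) := by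
  rw [edgeFunctional_apply, congruenceMapDeriv_apply, rigidityMap_apply]
  simp only [inner_starProjection_span_range]
  rw [← sub_sub, inner_sub_left]
  ring

theorem lengthSq_eq_of_congruenceMap_eq (G : LabeledGraph V E Γ)
    (L : Γ →+ EuclideanSpace ℝ (Fin d)) {p q : V → EuclideanSpace ℝ (Fin d)}
    (h : congruenceMap (Submodule.span ℝ (range L)) p =
      congruenceMap (Submodule.span ℝ (range L)) q) : G.lengthSq L p = G.lengthSq L q := by
  ext e
  rw [lengthSq_eq_edgeFunctional, lengthSq_eq_edgeFunctional, h]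

theorem ker_congruenceMapDeriv_le_ker_rigidityMap (G : LabeledGraph V E Γ)
    (L : Γ →+ EuclideanSpace ℝ (Fin d)) (q : V → EuclideanSpace ℝ (Fin d)) :
    (congruenceMapDeriv (Submodule.span ℝ (range L)) q).ker ≤ (G.rigidityMap L q).ker := by
  intro w hw
  have hw' : congruenceMapDeriv (Submodule.span ℝ (range L)) q w = 0 := hw
  refine funext fun e => ?_
  change G.rigidityMap L q w e = 0
  rw [rigidityMap_eq_edgeFunctional, hw', map_zero]

/-- The invariants `congruenceMap` and the squared lengths `f_{V,L}` carry the same information. -/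
theorem complete_lengthSq_eq_iff (L : Γ →+ EuclideanSpace ℝ (Fin d))
    {p q : V → EuclideanSpace ℝ (Fin d)} :
    (complete V Γ).lengthSq L p = (complete V Γ).lengthSq L q ↔
      congruenceMap (Submodule.span ℝ (range L)) p =
        congruenceMap (Submodule.span ℝ (range L)) q := by
  refine ⟨fun h => ?_, lengthSq_eq_of_congruenceMap_eq _ L⟩
  have h1 : ∀ u v γ, ‖p u - p v - L γ‖ ^ 2 = ‖q u - q v - L γ‖ ^ 2 := by
    intro u v γ
    rw [sub_sub, sub_sub]
    exact congrFun h (u, v, γ)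
  have h2 : ∀ u v, ‖p u - p v‖ ^ 2 = ‖q u - q v‖ ^ 2 := by
    intro u v
    simpa using h1 u v 0
  funext ⟨u, v⟩
  refine Prod.ext (h2 u v) ?_
  change Submodule.starProjection _ _ = Submodule.starProjection _ _
  rw [← sub_eq_zero, ← map_sub, Submodule.starProjection_apply_eq_zero_iff,
    Submodule.mem_orthogonal]
  intro z hz
  induction hz using Submodule.span_induction with
  | mem z hz =>
    obtain ⟨γ, rfl⟩ := hz
    have h3 := h1 u v γ
    rw [norm_sub_sq_real (p u - p v), norm_sub_sq_real (q u - q v), h2,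
      real_inner_comm (L γ), real_inner_comm (L γ)] at h3
    rw [inner_sub_right]
    linarith
  | zero => exact inner_zero_left _
  | add z z' _ _ h1 h2 => rw [inner_add_left, h1, h2, add_zero]
  | smul c z _ h1 => rw [real_inner_smul_left, h1, mul_zero]

/-- A globally rigid framework with distinct points is connected. -/
theorem IsPeriodicallyGloballyRigid.reflTransGen {G : LabeledGraph V E Γ}
    {L : Γ →+ EuclideanSpace ℝ (Fin d)} {p : V → EuclideanSpace ℝ (Fin d)}
    (hG : G.IsPeriodicallyGloballyRigid L p) (hp : Function.Injective p) (u v : V) :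
    Relation.ReflTransGen (fun a b => ∃ e, (G.src e = a ∧ G.tgt e = b) ∨
      (G.src e = b ∧ G.tgt e = a)) u v := by
  classical
  set r : V → V → Prop := fun a b => ∃ e, (G.src e = a ∧ G.tgt e = b) ∨
      (G.src e = b ∧ G.tgt e = a) with hr
  by_contra hv
  have hiff : ∀ e, Relation.ReflTransGen r u (G.src e) ↔ Relation.ReflTransGen r u (G.tgt e) :=
    fun e => ⟨fun h => h.tail ⟨e, Or.inl ⟨rfl, rfl⟩⟩, fun h => h.tail ⟨e, Or.inr ⟨rfl, rfl⟩⟩⟩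
  -- Translating everything not connected to `u` changes no edge length but moves `v` onto `u`.
  let q : V → EuclideanSpace ℝ (Fin d) := fun a =>
    if Relation.ReflTransGen r u a then p a else p a + (p u - p v)
  have h1 : G.lengthSq L p = G.lengthSq L q := by
    ext e
    by_cases h : Relation.ReflTransGen r u (G.src e)
    · simp only [lengthSq, q, if_pos h, if_pos ((hiff e).1 h)]
    · simp only [lengthSq, q, if_neg h, if_neg (mt (hiff e).2 h)]
      congr 2
      abel
  have h2 := congrFun (hG q h1) (u, v, 0)
  have h3 : q u = p u := if_pos Relation.ReflTransGen.refl
  have h4 : q v = p u := by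
    change (if _ then _ else _) = _
    rw [if_neg hv]
    abel
  simp only [lengthSq, complete, map_zero, add_zero, h3, h4, sub_self, norm_zero] at h2
  have h5 : p u = p v := by
    rw [← sub_eq_zero, ← norm_eq_zero]
    simpa using h2
  exact hv (hp h5 ▸ Relation.ReflTransGen.refl)

/-- Realizations of a connected graph with bounded edge lengths are bounded. -/
theorem exists_norm_sub_le_of_reflTransGen {G : LabeledGraph V E Γ}
    {L : Γ →+ EuclideanSpace ℝ (Fin d)} (p : V → EuclideanSpace ℝ (Fin d)) {u v : V}
    (h : Relation.ReflTransGen (fun a b => ∃ e, (G.src e = a ∧ G.tgt e = b) ∨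
      (G.src e = b ∧ G.tgt e = a)) u v) :
    ∃ C, ∀ q, (∀ e, G.lengthSq L q e ≤ G.lengthSq L p e) → ‖q v - q u‖ ≤ C := by
  induction h with
  | refl => exact ⟨0, fun q _ => by simp⟩
  | @tail a b _ hab ih =>
    obtain ⟨C, hC⟩ := ih
    obtain ⟨e, he⟩ := hab
    refine ⟨C + (√(G.lengthSq L p e) + ‖L (G.label e)‖), fun q hq => ?_⟩
    have h1 : ‖q (G.src e) - q (G.tgt e)‖ ≤ √(G.lengthSq L p e) + ‖L (G.label e)‖ := by
      have h2 : ‖q (G.src e) - (q (G.tgt e) + L (G.label e))‖ ≤ √(G.lengthSq L p e) :=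
        Real.le_sqrt_of_sq_le (hq e)
      calc ‖q (G.src e) - q (G.tgt e)‖
          = ‖q (G.src e) - (q (G.tgt e) + L (G.label e)) + L (G.label e)‖ := by
            congr 1
            abel
        _ ≤ _ := (norm_add_le _ _).trans (by linarith)
    have h3 : ‖q b - q a‖ ≤ √(G.lengthSq L p e) + ‖L (G.label e)‖ := by
      rcases he with ⟨rfl, rfl⟩ | ⟨rfl, rfl⟩
      · rwa [norm_sub_rev]
      · exact h1
    calc ‖q b - q u‖ = ‖(q a - q u) + (q b - q a)‖ := by
          congr 1
          abel
      _ ≤ _ := (norm_add_le _ _).trans (add_le_add (hC q hq) h3)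

end LabeledGraph

/-! ### Infinitesimal rigidity, rigidity, and compactness -/

/-- If the kernel of the derivative of `f` exceeds that of `κ` by at most one dimension, then a linear
function `l` that separates them at `x₀` is a local coordinate for `κ` on the fibres of `f`. -/
theorem exists_nhds_eq_of_coordinate {X A B : Type*} [NormedAddCommGroup X] [NormedSpace ℝ X]
    [FiniteDimensional ℝ X] [NormedAddCommGroup A] [NormedSpace ℝ A] [FiniteDimensional ℝ A]
    [NormedAddCommGroup B] [NormedSpace ℝ B] {f : X → A} {κ : X → B} {f' : X → X →L[ℝ] A}
    {κ' : X → X →L[ℝ] B} {x₀ : X} (hfc : ContDiff ℝ 1 f) (hf : ∀ x, HasFDerivAt f (f' x) x)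
    (hκc : ContDiff ℝ 1 κ) (hκ : ∀ x, HasFDerivAt κ (κ' x) x) (hker : ∀ x, (κ' x).ker ≤ (f' x).ker)
    (hrank : ∀ x, Module.finrank ℝ (κ' x₀).ker ≤ Module.finrank ℝ (κ' x).ker)
    (hdim : Module.finrank ℝ (f' x₀).ker ≤ Module.finrank ℝ (κ' x₀).ker + 1)
    {l : B →L[ℝ] ℝ} {w : X} (hw : w ∈ (f' x₀).ker) (hlw : l (κ' x₀ w) ≠ 0) :
    ∃ N ∈ 𝓝 x₀, ∀ x ∈ N, ∀ x' ∈ N, f x = f x' → l (κ x) = l (κ x') → κ x = κ x' := by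
  have hle : ∀ x, (κ' x).ker ≤ ((f' x).prod (l.comp (κ' x))).ker := by
    intro x v hv
    have h1 : f' x v = 0 := hker x hv
    have h2 : κ' x v = 0 := hv
    refine Prod.ext h1 ?_
    change l (κ' x v) = 0
    rw [h2, map_zero]
  have hlt : ((f' x₀).prod (l.comp (κ' x₀))).ker < (f' x₀).ker := by
    refine lt_of_le_of_ne (fun v hv => congrArg Prod.fst hv) fun heq => hlw ?_
    rw [← heq] at hw
    exact congrArg Prod.snd hw
  have h₀ : (κ' x₀).ker = ((f' x₀).prod (l.comp (κ' x₀))).ker := by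
    refine Submodule.eq_of_le_of_finrank_le (hle x₀) ?_
    have := Submodule.finrank_lt_finrank_of_lt hlt
    omega
  obtain ⟨N, hN, h⟩ := exists_nhds_eq_of_ker_le (g := fun x => (f x, l (κ x)))
    (g' := fun x => (f' x).prod (l.comp (κ' x))) (hfc.prodMk (l.contDiff.comp hκc))
    (fun x => (hf x).prodMk (l.hasFDerivAt.comp x (hκ x))) hκ h₀.ge (Eventually.of_forall hle)
    (Eventually.of_forall hrank)
  exact ⟨N, hN, fun x hx x' hx' h1 h2 => h x hx x' hx' (Prod.ext h1 h2)⟩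

namespace LabeledGraph

variable {V E Γ : Type*} [AddCommGroup Γ] {d : ℕ}

/-- The kernel of the derivative of `f_{G,L}` is smallest at a generic realization. -/
theorem finrank_ker_rigidityMap_le_of_generic [Fintype V] [Fintype E] (G : LabeledGraph V E Γ)
    (L : Γ →+ EuclideanSpace ℝ (Fin d)) {p : V → EuclideanSpace ℝ (Fin d)}
    (hp : IsGenericRealization L p) (q : V → EuclideanSpace ℝ (Fin d)) :
    Module.finrank ℝ (G.rigidityMap L p).ker ≤ Module.finrank ℝ (G.rigidityMap L q).ker := by
  have h1 := G.finrank_range_rigidityMap_le_of_generic L hp q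
  have h2 := LinearMap.finrank_range_add_finrank_ker (G.rigidityMap L q).toLinearMap
  have h3 := LinearMap.finrank_range_add_finrank_ker (G.rigidityMap L p).toLinearMap
  omega

/-- A globally rigid framework that has maximal rank is infinitesimally rigid. -/
theorem IsPeriodicallyGloballyRigid.ker_rigidityMap_le [Fintype V] [Fintype E]
    {G : LabeledGraph V E Γ} {L : Γ →+ EuclideanSpace ℝ (Fin d)}
    {p : V → EuclideanSpace ℝ (Fin d)} (hG : G.IsPeriodicallyGloballyRigid L p)
    (hrank : ∀ q, Module.finrank ℝ (G.rigidityMap L p).ker ≤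
      Module.finrank ℝ (G.rigidityMap L q).ker) :
    (G.rigidityMap L p).ker ≤ (congruenceMapDeriv (Submodule.span ℝ (range L)) p).ker := by
  intro w hw
  by_contra hne
  have hne' : congruenceMapDeriv (Submodule.span ℝ (range L)) p w ≠ 0 := hne
  obtain ⟨l, hl⟩ := SeparatingDual.exists_ne_zero (R := ℝ) hne'
  have hst : HasStrictFDerivAt (fun q => l (congruenceMap (Submodule.span ℝ (range L)) q))
      (l.comp (congruenceMapDeriv (Submodule.span ℝ (range L)) p)) p :=
    l.hasStrictFDerivAt.comp p ((contDiff_congruenceMap _).contDiffAt.hasStrictFDerivAt'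
      (hasFDerivAt_congruenceMap _ p) one_ne_zero)
  -- A nontrivial infinitesimal motion would let `l` sweep a neighbourhood of its value along the
  -- fibre, whereas global rigidity makes it constant there.
  have h1 := image_fiber_mem_nhds (G.contDiff_lengthSq L) (G.hasFDerivAt_lengthSq L) hst
    (Eventually.of_forall hrank) ⟨w, hw, hl⟩ univ_mem
  have h2 : (fun q => l (congruenceMap (Submodule.span ℝ (range L)) q)) ''
      {q | q ∈ univ ∧ G.lengthSq L q = G.lengthSq L p} ⊆
      {l (congruenceMap (Submodule.span ℝ (range L)) p)} := by
    rintro _ ⟨q, ⟨-, hq⟩, rfl⟩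
    have := (complete_lengthSq_eq_iff L).1 (hG q hq.symm)
    simp only [this, mem_singleton_iff]
  have h3 := mem_interior_iff_mem_nhds.2 (mem_of_superset h1 h2)
  rw [interior_singleton] at h3
  exact h3

/-- An infinitesimally rigid framework at which the invariants have maximal rank is rigid. -/
theorem isPeriodicallyRigid_of_ker_le [Fintype V] [Fintype E]
    {G : LabeledGraph V E Γ} {L : Γ →+ EuclideanSpace ℝ (Fin d)}
    {p : V → EuclideanSpace ℝ (Fin d)}
    (hker : (G.rigidityMap L p).ker ≤ (congruenceMapDeriv (Submodule.span ℝ (range L)) p).ker)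
    (hrank : ∀ q : V → EuclideanSpace ℝ (Fin d),
      Module.finrank ℝ (congruenceMapDeriv (Submodule.span ℝ (range L)) p).ker ≤
      Module.finrank ℝ (congruenceMapDeriv (Submodule.span ℝ (range L)) q).ker) :
    G.IsPeriodicallyRigid L p := by
  obtain ⟨N, hN, h⟩ := exists_nhds_eq_of_ker_le (G.contDiff_lengthSq L) (G.hasFDerivAt_lengthSq L)
    (hasFDerivAt_congruenceMap _) hker
    (Eventually.of_forall (G.ker_congruenceMapDeriv_le_ker_rigidityMap L))
    (Eventually.of_forall hrank)
  obtain ⟨N', hN', hopen, hmem⟩ := mem_nhds_iff.1 hN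
  exact ⟨N', hopen, hmem, fun q hq hpq => (complete_lengthSq_eq_iff L).2
    (h p (mem_of_mem_nhds hN) q (hN' hq) hpq)⟩

/-- The invariants of the realizations with given edge lengths, one of which may shrink, form a
compact set. -/
theorem isCompact_image_congruenceMap [Fintype V] [Fintype E] [Nonempty V]
    {G : LabeledGraph V E Γ} {L : Γ →+ EuclideanSpace ℝ (Fin d)}
    {p : V → EuclideanSpace ℝ (Fin d)} (e : E)
    (hconn : ∀ u v, Relation.ReflTransGen (fun a b => ∃ e, (G.src e = a ∧ G.tgt e = b) ∨
      (G.src e = b ∧ G.tgt e = a)) u v) :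
    IsCompact (congruenceMap (Submodule.span ℝ (range L)) ''
      {q | (G.deleteEdge e).lengthSq L q = (G.deleteEdge e).lengthSq L p ∧
        G.lengthSq L q e ≤ G.lengthSq L p e}) := by
  classical
  obtain ⟨v₀⟩ := ‹Nonempty V›
  set F := {q : V → EuclideanSpace ℝ (Fin d) |
    (G.deleteEdge e).lengthSq L q = (G.deleteEdge e).lengthSq L p ∧
        G.lengthSq L q e ≤ G.lengthSq L p e} with hF
  have hFle : ∀ q ∈ F, ∀ e', G.lengthSq L q e' ≤ G.lengthSq L p e' := by
    rintro q ⟨h1, h2⟩ e'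
    by_cases he : e' = e
    · rwa [he]
    · exact (congrFun h1 ⟨e', he⟩).le
  choose C hC using fun v => exists_norm_sub_le_of_reflTransGen (G := G) (L := L) p (hconn v₀ v)
  have hcont := (G.contDiff_lengthSq L).continuous
  have hcont' := ((G.deleteEdge e).contDiff_lengthSq L).continuous
  have hFclosed : IsClosed F :=
    (isClosed_eq hcont' continuous_const).inter
      (isClosed_le ((continuous_apply e).comp hcont) continuous_const)
  have hcomp : IsCompact (F ∩ Set.pi univ fun v => Metric.closedBall (p v₀) (C v)) :=
    (isCompact_univ_pi fun v => isCompact_closedBall _ _).inter_left hFclosed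
  have himage : congruenceMap (Submodule.span ℝ (range L)) '' F =
      congruenceMap (Submodule.span ℝ (range L)) ''
        (F ∩ Set.pi univ fun v => Metric.closedBall (p v₀) (C v)) := by
    refine Subset.antisymm ?_ (image_mono inter_subset_left)
    rintro _ ⟨q, hq, rfl⟩
    let q₁ : V → EuclideanSpace ℝ (Fin d) := fun v =>
      LinearIsometry.id (R := ℝ) (q v) + (p v₀ - q v₀)
    have hq₁ : congruenceMap (Submodule.span ℝ (range L)) q₁ =
      congruenceMap (Submodule.span ℝ (range L)) q :=
      congruenceMap_isometry _ q LinearIsometry.id (fun z _ => rfl) _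
    refine ⟨q₁, ⟨⟨?_, ?_⟩, fun v _ => ?_⟩, hq₁⟩
    · rw [lengthSq_eq_of_congruenceMap_eq _ L hq₁]
      exact hq.1
    · rw [lengthSq_eq_of_congruenceMap_eq _ L hq₁]
      exact hq.2
    · have h2 : q₁ v - p v₀ = q v - q v₀ := by
        change q v + (p v₀ - q v₀) - p v₀ = _
        abel
      rw [mem_closedBall_iff_norm, h2]
      exact hC v q (hFle q hq)
  rw [himage]
  exact hcomp.image (contDiff_congruenceMap _).continuous

end LabeledGraph

/-! ### The curve of realizations of the graph without one edge -/

theorem lemma3p8 {V E Γ : Type*} [Fintype V] [Finite E] [AddCommGroup Γ] (d k : ℕ)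
    (hΓ : Nonempty (Γ ≃+ (Fin k → ℤ)))
    (L : Γ →+ EuclideanSpace ℝ (Fin d)) (hL : IsNonsingularLattice k L)
    (G : LabeledGraph V E Γ) (hloopless : G.IsLoopless) (hsemi : G.IsSemiSimple)
    (p : V → EuclideanSpace ℝ (Fin d)) (hp : IsGenericRealization L p)
    (hV : 1 ≤ k → d + 1 ≤ Fintype.card V) (hV' : k = 0 → d + 2 ≤ Fintype.card V)
    (hG : G.IsPeriodicallyGloballyRigid L p) :
    G.IsRedundantlyPeriodicallyRigid L p := by
  classical
  have := Fintype.ofFinite E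
  intro e
  -- For `d = 0` there is only one realization; a positive `d` supplies the coordinate used below to
  -- see that `p` is injective.
  rcases Nat.eq_zero_or_pos d with rfl | hd
  · exact ⟨univ, isOpen_univ, mem_univ _, fun q _ _ => by rw [Subsingleton.elim p q]⟩
  set U := Submodule.span ℝ (range L) with hU
  have hk : Module.finrank ℝ U = k := hL
  have hUd : Module.finrank ℝ U + Module.finrank ℝ Uᗮ = d := by
    rw [Submodule.finrank_add_finrank_orthogonal, finrank_euclideanSpace_fin]
  have hV1 : d + 1 ≤ Fintype.card V := by
    rcases Nat.eq_zero_or_pos k with h | h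
    · have := hV' h
      omega
    · exact hV h
  -- `Uᗮ` has dimension `d - k`, so for `k ≥ 1` the bound `d + 1` suffices, while `k = 0` requires
  -- `d + 2`.
  have hV2 : Module.finrank ℝ Uᗮ + 2 ≤ Fintype.card V := by
    rcases Nat.eq_zero_or_pos k with h | h
    · have := hV' h
      omega
    · have := hV h
      omega
  have : Nonempty V := Fintype.card_pos_iff.1 (by omega)
  set D := Module.finrank ℝ (EuclideanSpace ℝ (Fin d)) + Module.finrank ℝ (skewEnd Uᗮ) with hD
  have hDiff : ∀ q : V → EuclideanSpace ℝ (Fin d),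
      Module.finrank ℝ (congruenceMapDeriv U q).ker = D ∨
        D + 2 ≤ Module.finrank ℝ (congruenceMapDeriv U q).ker := by
    intro q
    rw [ker_congruenceMapDeriv]
    by_cases hq : SpansModulo U q
    · exact Or.inl (finrank_infinitesimalCongruences_of_spansModulo U hq)
    · exact Or.inr (add_two_le_finrank_infinitesimalCongruences U hq hV2)
  have hDp : Module.finrank ℝ (congruenceMapDeriv U p).ker = D := by
    rw [ker_congruenceMapDeriv]
    exact finrank_infinitesimalCongruences_of_spansModulo U (hp.spansModulo hV1 U)
  have hDle : ∀ q : V → EuclideanSpace ℝ (Fin d),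
      D ≤ Module.finrank ℝ (congruenceMapDeriv U q).ker := fun q => by
    rcases hDiff q with h | h <;> omega
  by_contra hnot
  set G' := G.deleteEdge e with hG'
  have hgen : ∀ q, Module.finrank ℝ (G'.rigidityMap L p).ker ≤
      Module.finrank ℝ (G'.rigidityMap L q).ker :=
    G'.finrank_ker_rigidityMap_le_of_generic L hp
  have hinf : (G.rigidityMap L p).ker ≤ (congruenceMapDeriv U p).ker :=
    hG.ker_rigidityMap_le (G.finrank_ker_rigidityMap_le_of_generic L hp)
  have hnle : ¬ (G'.rigidityMap L p).ker ≤ (congruenceMapDeriv U p).ker := fun h =>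
    hnot (LabeledGraph.isPeriodicallyRigid_of_ker_le h fun q => hDp.trans_le (hDle q))
  let l₀ := LabeledGraph.edgeFunctional (G.src e) (G.tgt e) (L (G.label e))
  -- A motion of `G'` that also preserves the length of `e` is a motion of `G`, hence trivial. So
  -- `l₀` detects the nontrivial motion.
  have hl₀ : ∀ w ∈ (G'.rigidityMap L p).ker, l₀ (congruenceMapDeriv U p w) = 0 →
      w ∈ (congruenceMapDeriv U p).ker := by
    intro w hw hlw
    refine hinf (funext fun e' => ?_)
    by_cases he : e' = e
    · subst he
      exact (G.rigidityMap_eq_edgeFunctional L p w e').trans hlw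
    · exact congrFun (show G'.rigidityMap L p w = 0 from hw) ⟨e', he⟩
  have hdimp : Module.finrank ℝ (G'.rigidityMap L p).ker = D + 1 := by
    refine le_antisymm ?_ ?_
    · let l : (G'.rigidityMap L p).ker →ₗ[ℝ] ℝ := (l₀.comp (congruenceMapDeriv U p)).toLinearMap ∘ₗ
        (G'.rigidityMap L p).ker.subtype
      have h1 := LinearMap.finrank_range_add_finrank_ker l
      have h2 : Module.finrank ℝ l.range ≤ 1 :=
        (Submodule.finrank_le _).trans (Module.finrank_self ℝ).le
      have h3 : Module.finrank ℝ l.ker ≤ D := by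
        rw [← hDp, LinearEquiv.finrank_eq (Submodule.equivMapOfInjective _
          (G'.rigidityMap L p).ker.subtype_injective l.ker)]
        refine Submodule.finrank_mono ?_
        rintro _ ⟨w, hw, rfl⟩
        exact hl₀ w w.2 hw
      omega
    · rw [← hDp]
      exact Submodule.finrank_lt_finrank_of_lt (lt_of_le_not_ge
        (G'.ker_congruenceMapDeriv_le_ker_rigidityMap L p) hnle)
  -- The derivation argument and maximality of the rank at `p` give equal ranks. The congruences
  -- then have dimension at most `D + 1`, and the gap forces exactly `D`.
  have hdim : ∀ q, G'.lengthSq L q = G'.lengthSq L p →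
      Module.finrank ℝ (G'.rigidityMap L q).ker = D + 1 ∧
        Module.finrank ℝ (congruenceMapDeriv U q).ker = D := by
    intro q hq
    have h1 := Submodule.finrank_mono (G'.range_rigidityMap_le_of_generic L hp hq)
    have h2 := LinearMap.finrank_range_add_finrank_ker (G'.rigidityMap L q).toLinearMap
    have h3 := LinearMap.finrank_range_add_finrank_ker (G'.rigidityMap L p).toLinearMap
    have h4 := hgen q
    have h5 : Module.finrank ℝ (congruenceMapDeriv U q).ker ≤
        Module.finrank ℝ (G'.rigidityMap L q).ker :=
      Submodule.finrank_mono (G'.ker_congruenceMapDeriv_le_ker_rigidityMap L q)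
    rcases hDiff q with h6 | h6 <;> constructor <;> omega
  have hpinj : Function.Injective p := fun u v huv => by
    have := AlgebraicIndependent.injective hp
      (a₁ := (u, ⟨0, hd⟩)) (a₂ := (v, ⟨0, hd⟩)) (by simp only [huv])
    exact congrArg Prod.fst this
  set Y := congruenceMap U '' {q | G'.lengthSq L q = G'.lengthSq L p ∧
    G.lengthSq L q e ≤ G.lengthSq L p e} with hY
  have hYc : CompactSpace Y :=
    isCompact_iff_compactSpace.1 (LabeledGraph.isCompact_image_congruenceMap e (hG.reflTransGen hpinj))
  let y₀ : Y := ⟨congruenceMap U p, p, ⟨rfl, le_refl _⟩, rfl⟩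
  have hlen : ∀ q, G.lengthSq L q e = l₀ (congruenceMap U q) + ‖L (G.label e)‖ ^ 2 := fun q =>
    G.lengthSq_eq_edgeFunctional L q e
  -- The only use of global rigidity on the curve: the boundary of `Y` is the single point `y₀`.
  have hlt : ∀ q, G'.lengthSq L q = G'.lengthSq L p → G.lengthSq L q e = G.lengthSq L p e →
      congruenceMap U q = congruenceMap U p := by
    intro q h1 h2
    refine ((LabeledGraph.complete_lengthSq_eq_iff L).1 (hG q (funext fun e' => ?_))).symm
    by_cases he : e' = e
    · rw [he, h2]
    · exact (congrFun h1 ⟨e', he⟩).symm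
  have hstrict : ∀ (l : (V × V → ℝ × EuclideanSpace ℝ (Fin d)) →L[ℝ] ℝ) q, HasStrictFDerivAt
      (fun q => l (congruenceMap U q)) (l.comp (congruenceMapDeriv U q)) q := fun l q =>
    l.hasStrictFDerivAt.comp q ((contDiff_congruenceMap _).contDiffAt.hasStrictFDerivAt'
      (hasFDerivAt_congruenceMap _ q) one_ne_zero)
  -- a linear function separating the two kernels is injective on `Y` near `q`
  have hinj : ∀ (y : Y) q, congruenceMap U q = y → G'.lengthSq L q = G'.lengthSq L p →
      ∀ (l : (V × V → ℝ × EuclideanSpace ℝ (Fin d)) →L[ℝ] ℝ), ∀ w ∈ (G'.rigidityMap L q).ker,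
      l (congruenceMapDeriv U q w) ≠ 0 → ∃ N ∈ 𝓝 y, InjOn (fun y : Y => l y) N := by
    intro y q hqy hq l w hw hlw
    obtain ⟨N, hN, hNinj⟩ := exists_nhds_eq_of_coordinate (G'.contDiff_lengthSq L)
      (G'.hasFDerivAt_lengthSq L) (contDiff_congruenceMap U) (hasFDerivAt_congruenceMap U)
      (G'.ker_congruenceMapDeriv_le_ker_rigidityMap L) (x₀ := q)
      (fun x => (hdim q hq).2.trans_le (hDle x))
      (by rw [(hdim q hq).1, (hdim q hq).2]) hw hlw
    obtain ⟨S, hS, hSN⟩ := exists_nhds_congruenceMap U hN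
    rw [hqy] at hS
    refine ⟨Subtype.val ⁻¹' S, continuous_subtype_val.continuousAt hS, ?_⟩
    rintro ⟨_, q₁, hq₁, rfl⟩ hS₁ ⟨_, q₂, hq₂, rfl⟩ hS₂ heq
    obtain ⟨r₁, hr₁, hr₁'⟩ := hSN q₁ hS₁
    obtain ⟨r₂, hr₂, hr₂'⟩ := hSN q₂ hS₂
    refine Subtype.ext ?_
    change congruenceMap U q₁ = congruenceMap U q₂
    rw [← hr₁', ← hr₂']
    refine hNinj r₁ hr₁ r₂ hr₂ ?_ ?_
    · rw [G'.lengthSq_eq_of_congruenceMap_eq L hr₁', G'.lengthSq_eq_of_congruenceMap_eq L hr₂',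
        hq₁.1, hq₂.1]
    · rw [hr₁', hr₂']
      exact heq
  -- and locally open on the fibre
  have hopen : ∀ q, G'.lengthSq L q = G'.lengthSq L p →
      ∀ (l : (V × V → ℝ × EuclideanSpace ℝ (Fin d)) →L[ℝ] ℝ), ∀ w ∈ (G'.rigidityMap L q).ker,
      l (congruenceMapDeriv U q w) ≠ 0 → ∀ N ∈ 𝓝 q, (fun x => l (congruenceMap U x)) ''
        {x | x ∈ N ∧ G'.lengthSq L x = G'.lengthSq L p} ∈ 𝓝 (l (congruenceMap U q)) := by
    intro q hq l w hw hlw N hN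
    rw [← hq]
    refine image_fiber_mem_nhds (G'.contDiff_lengthSq L) (G'.hasFDerivAt_lengthSq L) (hstrict l q)
      (Eventually.of_forall fun x => ?_) ⟨w, hw, hlw⟩ hN
    rw [(hdim q hq).1, ← hdimp]
    exact hgen x
  have hcont : Continuous (congruenceMap U : (V → EuclideanSpace ℝ (Fin d)) → _) :=
    (contDiff_congruenceMap U).continuous
  have harc : ∀ y ≠ y₀, ∃ θ ε, IsArcAt θ ε y := by
    rintro ⟨_, q, ⟨hq, hqe⟩, rfl⟩ hne
    have hqlt : G.lengthSq L q e < G.lengthSq L p e :=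
      lt_of_le_of_ne hqe fun h => hne (Subtype.ext (hlt q hq h))
    obtain ⟨w, hw, hw'⟩ := SetLike.not_le_iff_exists.1 fun h :
        (G'.rigidityMap L q).ker ≤ (congruenceMapDeriv U q).ker => by
      have := Submodule.finrank_mono h
      rw [(hdim q hq).1, (hdim q hq).2] at this
      omega
    obtain ⟨l, hl⟩ := SeparatingDual.exists_ne_zero (R := ℝ)
      (show congruenceMapDeriv U q w ≠ 0 from hw')
    obtain ⟨N, hN, hNinj⟩ := hinj ⟨congruenceMap U q, q, ⟨hq, hqe⟩, rfl⟩ q rfl hq l w hw hl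
    refine exists_isArcAt (l.continuous.comp continuous_subtype_val) hN hNinj fun T hT => ?_
    obtain ⟨S, hS, hST⟩ := mem_nhds_subtype _ _ _ |>.1 hT
    -- Away from `y₀` the inequality on the length of `e` is strict, so nearby points of the fibre
    -- remain in `Y`.
    have hM : {x | congruenceMap U x ∈ S ∧ G.lengthSq L x e < G.lengthSq L p e} ∈ 𝓝 q := by
      refine inter_mem (hcont.continuousAt hS) ?_
      exact (isOpen_lt ((continuous_apply e).comp (G.contDiff_lengthSq L).continuous)
        continuous_const).mem_nhds hqlt
    refine mem_of_superset (hopen q hq l w hw hl _ hM) ?_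
    rintro _ ⟨x, ⟨⟨hxS, hxe⟩, hx⟩, rfl⟩
    exact hST (show (⟨congruenceMap U x, x, ⟨hx, hxe.le⟩, rfl⟩ : Y) ∈ Subtype.val ⁻¹' S from hxS)
  obtain ⟨θ, ε, hθ⟩ : ∃ θ ε, IsHalfArcAt θ ε y₀ := by
    obtain ⟨w, hw, hw'⟩ := SetLike.not_le_iff_exists.1 hnle
    have hl : l₀ (congruenceMapDeriv U p w) ≠ 0 := fun h => hw' (hl₀ w hw h)
    obtain ⟨N, hN, hNinj⟩ := hinj y₀ p rfl rfl l₀ w hw hl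
    -- At `y₀` the length of `e` is itself the coordinate, and by definition of `Y` it is maximal
    -- there, so the arc is one-sided.
    refine exists_isHalfArcAt (l₀.continuous.comp continuous_subtype_val) ?_ hN hNinj
      fun T hT => ?_
    · rintro ⟨_, q, ⟨-, hqe⟩, rfl⟩
      rw [hlen, hlen] at hqe
      exact le_of_add_le_add_right hqe
    · obtain ⟨S, hS, hST⟩ := mem_nhds_subtype _ _ _ |>.1 hT
      refine mem_nhdsWithin_iff_exists_mem_nhds_inter.2
        ⟨_, hopen p rfl l₀ w hw hl _ (hcont.continuousAt hS), ?_⟩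
      rintro _ ⟨⟨x, ⟨hxS, hx⟩, rfl⟩, hle⟩
      have hxe : G.lengthSq L x e ≤ G.lengthSq L p e := by
        rw [hlen, hlen]
        exact add_le_add_left hle _
      exact hST (show (⟨congruenceMap U x, x, ⟨hx, hxe⟩, rfl⟩ : Y) ∈ Subtype.val ⁻¹' S from hxS)
  exact not_isHalfArcAt_of_isArcAt harc hθ
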